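/- **Definitions.** Let $S$ be a nonempty set and let $\mathcal F$ be a set of finite subsets of $S$ that contains $\emptyset$ and $\{s\}$ for every $s\in S$, and such that $F\cup F'\in\mathcal F$ whenever $F,F'\in\mathcal F$ and $F\cap F'\neq\emptyset$. A set $C\subseteq S$ is *connected* if for any $x,y\in C$ there is $F\in\mathcal F$ with $F\subseteq C$ and $x,y\in F$. Let $\mathcal C$ be the set of connected sets; the pair $(S,\mathcal C)$ is called a *connectoid*, and it is a *connected connectoid* if $S\in\mathcal C$. For $S'\subseteq S$, the *induced subconnectoid* on $S'$ is the connectoid $(S',\{C\in\mathcal C: C\subseteq S'\})$. A *component* of a set $A\subseteq S$ is a maximal connected subset of $A$. A *necklace* is a connected set $N=\bigcup_{n\in\mathbb N}H_n$, where the $H_n$ are finite connected sets such that $H_i\cap H_j\neq\emptyset$ if and only if $|i-j|\le 1$. For every finite $X\subseteq S$ there is exactly one infinite component of $N\setminus X$, called the *$X$-tail* of $N$. Two necklaces are *equivalent* if for every finite $X\subseteq S$ their $X$-tails are contained in the same component of $S\setminus X$; the equivalence classes are the *ends* of $(S,\mathcal C)$, and $\Omega(S,\mathcal C)$ denotes the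 set of ends. For a finite set $X\subseteq S$ and an end $\omega$, let $K(X,\omega)$ be the unique component of $S\setminus X$ that contains a necklace of $\omega$. A *normal tree* of $(S,\mathcal C)$ is a rooted (undirected) tree $T$ with $V(T)\subseteq S$ and tree order $\le_T$ such that 1. for any $C\in\mathcal C$ and any $\le_T$-incomparable $u,v\in C\cap V(T)$ there is $w\in C$ with $w\le_T u$ and $w\le_T v$; 2. for any $u\le_T v$ there is $C\in\mathcal C$ with $u,v\in C$ that contains no $w<_T u$; 3. for any ray $R$ in $T$ starting at the root there is a necklace of $(S,\mathcal C)$ that contains all but finitely many vertices of $R$. The tree $T$ *contains* a set $U$ if $U\subseteq V(T)$. **Theorem.** Let $(S,\mathcal C)$ be a connected connectoid with $S\neq\emptyset$, and let $U\subseteq S$. Then $(S,\mathcal C)$ has a normal tree containing $U$ if and only if for every end $\omega\in\Omega(S,\mathcal C)$ there is a finite set $X_\omega\subseteq S$ such that the induced subconnectoid on $K(X_\omega,\omega)$ has a normal tree containing $U\cap K(X_\omega,\omega)$. -/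

import Mathlib

/-- A connectoid `(S, 𝒞)` on a groundset `S ⊆ α`, given by the family `bonds` of its finite
connected sets; the family `𝒞` of all connected sets is `Connectoid.Conn`. -/
structure Connectoid (α : Type*) where
  /-- the groundset `S` -/
  ground : Set α
  /-- the family `ℱ` of finite connected sets -/
  bonds : Set (Set α)
  subset_ground : ∀ F ∈ bonds, F ⊆ ground
  finite_of_mem : ∀ F ∈ bonds, F.Finite
  union_mem : ∀ F ∈ bonds, ∀ F' ∈ bonds, (F ∩ F').Nonempty → F ∪ F' ∈ bonds
  singleton_mem : ∀ s ∈ ground, {s} ∈ bonds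
  empty_mem : ∅ ∈ bonds

namespace Connectoid

variable {α : Type*} (C : Connectoid α)

/-- Connected sets: any two elements lie in a common member of `bonds` contained in the set. -/
def Conn (A : Set α) : Prop :=
  ∀ x ∈ A, ∀ y ∈ A, ∃ F ∈ C.bonds, F ⊆ A ∧ x ∈ F ∧ y ∈ F

/-- A connectoid is connected if its groundset is a connected set. -/
def IsConnected : Prop := C.Conn C.ground

/-- `K` is a component of `A`, that is `K ∈ 𝒦(A)`: a maximal connected subset of `A`. -/
def IsComponent (A K : Set α) : Prop :=
  Maximal (fun B : Set α => B ⊆ A ∧ C.Conn B) K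

/-- Necklaces. -/
def IsNecklace (N : Set α) : Prop :=
  C.Conn N ∧ ∃ H : ℕ → Set α, (∀ n, (H n).Finite ∧ C.Conn (H n)) ∧ N = ⋃ n, H n ∧
    ∀ i j : ℕ, (H i ∩ H j).Nonempty ↔ |(i : ℤ) - (j : ℤ)| ≤ 1

/-- The induced subconnectoid on `S'` (for `S' ⊆ S` its groundset is `S'`). -/
def induce (S' : Set α) : Connectoid α where
  ground := C.ground ∩ S'
  bonds := {F | F ∈ C.bonds ∧ F ⊆ S'}
  subset_ground := fun F hF => Set.subset_inter (C.subset_ground F hF.1) hF.2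
  finite_of_mem := fun F hF => C.finite_of_mem F hF.1
  union_mem := fun F hF F' hF' h =>
    ⟨C.union_mem F hF.1 F' hF'.1 h, Set.union_subset hF.2 hF'.2⟩
  singleton_mem := fun s hs => ⟨C.singleton_mem s hs.1, Set.singleton_subset_iff.2 hs.2⟩
  empty_mem := ⟨C.empty_mem, Set.empty_subset _⟩

/-- For `S' ⊆ S`, the groundset of the induced subconnectoid on `S'` is `S'`. -/
theorem induce_ground {S' : Set α} (h : S' ⊆ C.ground) : (C.induce S').ground = S' :=
  Set.inter_eq_right.2 h

/-- The connected sets of the induced subconnectoid on `S'` are the connected subsets of `S'`. -/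
theorem conn_induce_iff (S' A : Set α) : (C.induce S').Conn A ↔ C.Conn A ∧ A ⊆ S' := by
  constructor
  · intro h
    refine ⟨fun x hx y hy => ?_, fun x hx => ?_⟩
    · obtain ⟨F, hF, h1, h2, h3⟩ := h x hx y hy
      exact ⟨F, hF.1, h1, h2, h3⟩
    · obtain ⟨F, hF, -, h2, -⟩ := h x hx x hx
      exact hF.2 h2
  · rintro ⟨h, hA⟩ x hx y hy
    obtain ⟨F, hF, h1, h2, h3⟩ := h x hx y hy
    exact ⟨F, ⟨hF, h1.trans hA⟩, h1, h2, h3⟩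

variable {C}

theorem Conn.subset_ground {A : Set α} (h : C.Conn A) : A ⊆ C.ground := by
  intro x hx
  obtain ⟨F, hF, -, h2, -⟩ := h x hx x hx
  exact C.subset_ground F hF h2

theorem conn_of_common_point {P : Set (Set α)} {z : α} (h : ∀ A ∈ P, C.Conn A)
    (hz : ∀ A ∈ P, z ∈ A) : C.Conn (⋃₀ P) := by
  rintro x ⟨A, hA, hx⟩ y ⟨B, hB, hy⟩
  obtain ⟨F, hF, h1, h2, h3⟩ := h A hA x hx z (hz A hA)
  obtain ⟨G, hG, g1, g2, g3⟩ := h B hB z (hz B hB) y hy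
  refine ⟨F ∪ G, C.union_mem F hF G hG ⟨z, h3, g2⟩, ?_, Or.inl h2, Or.inr g3⟩
  exact Set.union_subset (h1.trans (Set.subset_sUnion_of_mem hA))
    (g1.trans (Set.subset_sUnion_of_mem hB))

theorem Conn.union {A B : Set α} (hA : C.Conn A) (hB : C.Conn B) (h : (A ∩ B).Nonempty) :
    C.Conn (A ∪ B) := by
  obtain ⟨z, hzA, hzB⟩ := h
  rw [← Set.sUnion_pair]
  refine conn_of_common_point (z := z) ?_ ?_
  · rintro D (rfl | rfl) <;> assumption
  · rintro D (rfl | rfl) <;> assumption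

theorem exists_component {Y A : Set α} (hA : C.Conn A) (hAY : A ⊆ Y) (hne : A.Nonempty) :
    ∃ K, C.IsComponent Y K ∧ A ⊆ K := by
  obtain ⟨z, hz⟩ := hne
  have hmem : A ∈ {B | (B ⊆ Y ∧ C.Conn B) ∧ A ⊆ B} := ⟨⟨hAY, hA⟩, subset_rfl⟩
  refine ⟨⋃₀ {B | (B ⊆ Y ∧ C.Conn B) ∧ A ⊆ B}, ⟨⟨?_, ?_⟩, ?_⟩, ?_⟩
  · exact Set.sUnion_subset fun B hB => hB.1.1
  · exact conn_of_common_point (z := z) (fun B hB => hB.1.2) fun B hB => hB.2 hz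
  · intro D hD hle
    refine Set.subset_sUnion_of_mem ⟨hD, ?_⟩
    exact (Set.subset_sUnion_of_mem hmem).trans hle
  · exact Set.subset_sUnion_of_mem hmem

theorem IsComponent.subset_of_conn {Y K A : Set α} (hK : C.IsComponent Y K) (hA : C.Conn A)
    (hAY : A ⊆ Y) (h : (A ∩ K).Nonempty) : A ⊆ K := by
  have h1 := hK.2 (y := K ∪ A)
    ⟨Set.union_subset hK.1.1 hAY, hK.1.2.union hA (by rwa [Set.inter_comm] at h)⟩
    Set.subset_union_left
  exact Set.subset_union_right.trans h1

theorem IsComponent.eq_of_inter {Y K L : Set α} (hK : C.IsComponent Y K)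
    (hL : C.IsComponent Y L) (h : (K ∩ L).Nonempty) : K = L :=
  (hL.subset_of_conn hK.1.2 hK.1.1 h).antisymm
    (hK.subset_of_conn hL.1.2 hL.1.1 (by rwa [Set.inter_comm]))

/-- Deleting a finite set from a necklace leaves a cofinite part which is again a necklace. -/
theorem IsNecklace.exists_sub {N : Set α} (hN : C.IsNecklace N) (X : Finset α) :
    ∃ M, C.IsNecklace M ∧ M ⊆ N \ X ∧ (N \ M).Finite := by
  obtain ⟨-, H, hH, rfl, hI⟩ := hN
  have hne : ∀ n, (H n).Nonempty := fun n => by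
    simpa using (hI n n).2 (by simp)
  have hfin : {n | (H n ∩ X).Nonempty}.Finite := by
    have hx : ∀ x : α, {n | x ∈ H n}.Finite := by
      intro x
      by_cases h : ∃ m, x ∈ H m
      · obtain ⟨m, hm⟩ := h
        refine (Set.finite_Iic (m + 1)).subset fun n hn => ?_
        have h1 := (hI n m).1 ⟨x, hn, hm⟩
        rw [abs_le] at h1
        simp only [Set.mem_Iic]
        omega
      · refine Set.finite_empty.subset fun n hn => h ⟨n, hn⟩
    refine (X.finite_toSet.biUnion fun x _ => hx x).subset ?_
    rintro n ⟨x, h1, h2⟩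
    simp only [Set.mem_iUnion]
    exact ⟨x, h2, h1⟩
  obtain ⟨m, hm⟩ := hfin.bddAbove
  have hconn : C.Conn (⋃ k, H (m + 1 + k)) := by
    obtain ⟨z, hz⟩ := hne (m + 1)
    have hP : ∀ n, C.Conn (⋃ k ∈ Set.Iic n, H (m + 1 + k)) := by
      intro n
      induction n with
      | zero =>
        have : (⋃ k ∈ Set.Iic 0, H (m + 1 + k)) = H (m + 1) := by
          ext x; simp
        rw [this]
        exact (hH _).2
      | succ n ih =>
        have : (⋃ k ∈ Set.Iic (n + 1), H (m + 1 + k)) =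
            (⋃ k ∈ Set.Iic n, H (m + 1 + k)) ∪ H (m + 1 + (n + 1)) := by
          ext x
          simp only [Set.mem_iUnion, Set.mem_Iic, Set.mem_union, exists_prop]
          constructor
          · rintro ⟨k, hk, hx⟩
            rcases Nat.lt_or_ge n k with h | h
            · obtain rfl : k = n + 1 := by omega
              exact Or.inr hx
            · exact Or.inl ⟨k, h, hx⟩
          · rintro (⟨k, hk, hx⟩ | hx)
            · exact ⟨k, by omega, hx⟩
            · exact ⟨n + 1, le_rfl, hx⟩
        rw [this]
        refine ih.union (hH _).2 ?_
        obtain ⟨x, h1, h2⟩ := (hI (m + 1 + n) (m + 1 + (n + 1))).2 (by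
          rw [abs_le]; push_cast; constructor <;> linarith)
        exact ⟨x, Set.mem_biUnion (Set.mem_Iic.2 le_rfl) h1, h2⟩
    have : (⋃ k, H (m + 1 + k)) =
        ⋃₀ (Set.range fun n => ⋃ k ∈ Set.Iic n, H (m + 1 + k)) := by
      ext x
      simp only [Set.sUnion_range, Set.mem_iUnion, Set.mem_Iic, exists_prop]
      exact ⟨fun ⟨k, hk⟩ => ⟨k, k, le_rfl, hk⟩, fun ⟨_, k, _, hk⟩ => ⟨k, hk⟩⟩
    rw [this]
    refine conn_of_common_point (z := z) ?_ ?_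
    · rintro A ⟨n, rfl⟩
      exact hP n
    · rintro A ⟨n, rfl⟩
      exact Set.mem_biUnion (Set.mem_Iic.2 (Nat.zero_le n)) hz
  refine ⟨⋃ k, H (m + 1 + k), ⟨hconn, fun k => H (m + 1 + k), fun k => hH _, rfl, ?_⟩, ?_, ?_⟩
  · intro i j
    rw [hI]
    push_cast
    rw [add_sub_add_left_eq_sub]
  · intro x hx
    obtain ⟨k, hk⟩ := Set.mem_iUnion.1 hx
    refine ⟨Set.mem_iUnion.2 ⟨_, hk⟩, fun hX => ?_⟩
    have := hm (show m + 1 + k ∈ {n | (H n ∩ X).Nonempty} from ⟨x, hk, hX⟩)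
    omega
  · refine ((Set.finite_Iic m).biUnion fun n _ => (hH n).1).subset ?_
    rintro x ⟨hx, hx'⟩
    obtain ⟨n, hn⟩ := Set.mem_iUnion.1 hx
    refine Set.mem_biUnion (Set.mem_Iic.2 ?_) hn
    by_contra h
    refine hx' (Set.mem_iUnion.2 ⟨n - (m + 1), ?_⟩)
    have : m + 1 + (n - (m + 1)) = n := by omega
    rwa [this]

theorem IsNecklace.infinite {N : Set α} (hN : C.IsNecklace N) : N.Infinite := by
  intro hfin
  obtain ⟨M, ⟨-, H, -, rfl, hI⟩, hM, -⟩ := hN.exists_sub hfin.toFinset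
  obtain ⟨x, hx, -⟩ := (hI 0 0).2 (by simp)
  have := hM (Set.mem_iUnion.2 ⟨0, hx⟩)
  simp at this

/-- For every finite set `X`, exactly one component of `N \ X` is infinite. -/
theorem IsNecklace.existsUnique_tail {N : Set α} (hN : C.IsNecklace N) (X : Finset α) :
    ∃! A, C.IsComponent (N \ X) A ∧ A.Infinite := by
  obtain ⟨M, hM, hMN, hfin⟩ := hN.exists_sub X
  obtain ⟨K, hK, hMK⟩ := exists_component hM.1 hMN hM.infinite.nonempty
  have key : ∀ A, C.IsComponent (N \ X) A → A.Infinite → (A ∩ M).Nonempty := by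
    intro A hA hinf
    by_contra h
    refine hinf (hfin.subset fun x hx => ⟨(hA.1.1 hx).1, fun hxM => h ⟨x, hx, hxM⟩⟩)
  refine ⟨K, ⟨hK, hM.infinite.mono hMK⟩, ?_⟩
  rintro A ⟨hA, hinf⟩
  obtain ⟨x, hxA, hxM⟩ := key A hA hinf
  exact hA.eq_of_inter hK ⟨x, hxA, hMK hxM⟩

variable (C)

/-- The necklaces of a connectoid. -/
def Necklace : Type _ := {N : Set α // C.IsNecklace N}

variable {C}

/-- The `X`-tail of a necklace `N`: the unique infinite component of `N \ X`. -/
noncomputable def Necklace.tail (N : C.Necklace) (X : Finset α) : Set α :=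
  (N.2.existsUnique_tail X).choose

theorem Necklace.tail_spec (N : C.Necklace) (X : Finset α) :
    C.IsComponent (N.1 \ X) (N.tail X) ∧ (N.tail X).Infinite :=
  (N.2.existsUnique_tail X).choose_spec.1

/-- Two necklaces are equivalent if for every finite set `X` their `X`-tails are contained in the
same component of `S \ X`. Elements of `X` outside the groundset `S` play no role. -/
def Necklace.Equivalent (N N' : C.Necklace) : Prop :=
  ∀ X : Finset α, ∃ K, C.IsComponent (C.ground \ X) K ∧ N.tail X ⊆ K ∧ N'.tail X ⊆ K

variable (C)

/-- Equivalence of necklaces as a setoid. -/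
def necklaceSetoid : Setoid C.Necklace where
  r := Necklace.Equivalent
  iseqv := by
    refine ⟨fun N X => ?_, fun h X => ?_, fun {N N' N''} h h' X => ?_⟩
    · have hN := N.tail_spec X
      have hsub : N.tail X ⊆ C.ground \ X := fun x hx =>
        ⟨hN.1.1.2.subset_ground hx, (hN.1.1.1 hx).2⟩
      obtain ⟨K, hK, h⟩ := exists_component hN.1.1.2 hsub hN.2.nonempty
      exact ⟨K, hK, h, h⟩
    · obtain ⟨K, hK, h1, h2⟩ := h X
      exact ⟨K, hK, h2, h1⟩
    · obtain ⟨K, hK, h1, h2⟩ := h X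
      obtain ⟨L, hL, h3, h4⟩ := h' X
      obtain ⟨x, hx⟩ := (N'.tail_spec X).2.nonempty
      obtain rfl := hK.eq_of_inter hL ⟨x, h2 hx, h3 hx⟩
      exact ⟨K, hK, h1, h4⟩

/-- `Ω(S, 𝒞)`: the ends of a connectoid, that is the equivalence classes of necklaces. -/
def Ends : Type _ := Quotient C.necklaceSetoid

variable {C}

/-- `N` is a necklace of the end `ω`, that is, `N` belongs to the equivalence class `ω`. -/
def Necklace.MemEnd (N : C.Necklace) (ω : C.Ends) : Prop :=
  Quotient.mk C.necklaceSetoid N = ω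

theorem Necklace.tail_subset (N : C.Necklace) {X : Finset α} {K : Set α}
    (h : N.1 ⊆ K) : N.tail X ⊆ K :=
  fun _ hx => h ((N.tail_spec X).1.1.1 hx).1

/-- Exactly one component of `S \ X` contains a necklace of the end `ω`. -/
theorem existsUnique_endComponent (X : Finset α) (ω : C.Ends) :
    ∃! K, C.IsComponent (C.ground \ X) K ∧ ∃ N : C.Necklace, N.MemEnd ω ∧ N.1 ⊆ K := by
  obtain ⟨N, rfl⟩ := Quotient.exists_rep ω
  obtain ⟨M, hM, hMN, hfin⟩ := N.2.exists_sub X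
  have hMX : M ⊆ C.ground \ X := fun x hx => ⟨hM.1.subset_ground hx, (hMN hx).2⟩
  obtain ⟨K, hK, hMK⟩ := exists_component hM.1 hMX hM.infinite.nonempty
  have hequiv : Necklace.Equivalent (⟨M, hM⟩ : C.Necklace) N := by
    intro Y
    have h1 := Necklace.tail_spec (⟨M, hM⟩ : C.Necklace) Y
    have h2 := N.tail_spec Y
    have hsub : N.tail Y ⊆ C.ground \ Y := fun x hx =>
      ⟨h2.1.1.2.subset_ground hx, (h2.1.1.1 hx).2⟩
    obtain ⟨L, hL, h⟩ := exists_component h2.1.1.2 hsub h2.2.nonempty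
    refine ⟨L, hL, Set.Subset.trans ?_ h, h⟩
    have h3 : Necklace.tail (⟨M, hM⟩ : C.Necklace) Y ⊆ N.1 \ Y := fun x hx =>
      ⟨(hMN (h1.1.1.1 hx).1).1, (h1.1.1.1 hx).2⟩
    obtain ⟨A, hA, hsubA⟩ := exists_component h1.1.1.2 h3 h1.2.nonempty
    have : A = N.tail Y :=
      (N.2.existsUnique_tail Y).unique ⟨hA, h1.2.mono hsubA⟩ h2
    exact this ▸ hsubA
  refine ⟨K, ⟨hK, ⟨M, hM⟩, Quotient.sound hequiv, hMK⟩, ?_⟩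
  rintro L ⟨hL, P, hP, hPL⟩
  have hPM : Necklace.Equivalent P ⟨M, hM⟩ :=
    C.necklaceSetoid.trans (Quotient.exact hP) (C.necklaceSetoid.symm hequiv)
  obtain ⟨D, hD, h1, h2⟩ := hPM X
  obtain ⟨x, hx⟩ := (P.tail_spec X).2.nonempty
  obtain ⟨y, hy⟩ := (Necklace.tail_spec (⟨M, hM⟩ : C.Necklace) X).2.nonempty
  rw [hL.eq_of_inter hD ⟨x, P.tail_subset hPL hx, h1 hx⟩,
    hK.eq_of_inter hD ⟨y, Necklace.tail_subset (⟨M, hM⟩ : C.Necklace) hMK hy, h2 hy⟩]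

variable (C)

/-- `K(X, ω)`: the unique component of `S \ X` containing a necklace of `ω`. -/
noncomputable def endComponent (X : Finset α) (ω : C.Ends) : Set α :=
  (existsUnique_endComponent X ω).choose

theorem endComponent_spec (X : Finset α) (ω : C.Ends) :
    C.IsComponent (C.ground \ X) (C.endComponent X ω) ∧
      ∃ N : C.Necklace, N.MemEnd ω ∧ N.1 ⊆ C.endComponent X ω :=
  (existsUnique_endComponent X ω).choose_spec.1

end Connectoid

/-- A rooted undirected tree whose vertices are elements of `α`. -/
structure RootedGraphTree (α : Type*) where
  /-- the tree, as a subgraph of the complete graph on `α` -/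
  graph : (⊤ : SimpleGraph α).Subgraph
  root : α
  root_mem : root ∈ graph.verts
  isTree : graph.coe.IsTree

namespace RootedGraphTree

variable {α : Type*} (T : RootedGraphTree α)

/-- The vertex set `V(T)`. -/
def verts : Set α := T.graph.verts

/-- The tree order: `u ≤_T v` if `u` lies on the (unique) path in `T` from the root to `v`. -/
def le (u v : α) : Prop :=
  ∃ (hu : u ∈ T.graph.verts) (hv : v ∈ T.graph.verts)
    (p : T.graph.coe.Walk ⟨T.root, T.root_mem⟩ ⟨v, hv⟩), p.IsPath ∧ ⟨u, hu⟩ ∈ p.support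

/-- `R 0, R 1, R 2, …` are the vertices of a rooted ray of `T`: a one-way infinite path in `T`
that starts at the root. -/
def IsRootedRay (R : ℕ → α) : Prop :=
  R 0 = T.root ∧ Function.Injective R ∧ ∀ n, T.graph.Adj (R n) (R (n + 1))

end RootedGraphTree

namespace Connectoid

variable {α : Type*} (C : Connectoid α)

/-- Weak normal trees of a connectoid. -/
structure IsWeakNormalTree (T : RootedGraphTree α) : Prop where
  verts_subset : T.verts ⊆ C.ground
  incomparable : ∀ A, C.Conn A → ∀ u ∈ A ∩ T.verts, ∀ v ∈ A ∩ T.verts,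
    ¬ T.le u v → ¬ T.le v u → ∃ w ∈ A, T.le w u ∧ T.le w v
  comparable : ∀ u v, T.le u v →
    ∃ A, C.Conn A ∧ u ∈ A ∧ v ∈ A ∧ ∀ w, T.le w u → w ≠ u → w ∉ A

/-- Normal trees of a connectoid: weak normal trees such that for every rooted ray some necklace
contains all but finitely many of its vertices. -/
structure IsNormalTree (T : RootedGraphTree α) : Prop extends C.IsWeakNormalTree T where
  ray : ∀ R : ℕ → α, T.IsRootedRay R → ∃ N, C.IsNecklace N ∧ (Set.range R \ N).Finite

end Connectoid

/-! ### Necklaces from sequences of finite connected sets, and components. -/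

namespace Connectoid

variable {α : Type*} {C : Connectoid α}

/-! The theorem reduces to a notion that no longer mentions trees. A set is dispersed if a finite
set separates it from every necklace, and σ-dispersed if countably many dispersed sets cover it. The
forward implication is the choice `X = ∅`; the converse has three steps.

Trees give σ-dispersed sets (`IsWeakNormalTree.sigmaDispersed`): a necklace is pushed off the levels
of a normal tree one at a time, since a connected set meeting the tree has a least tree vertex, and
deleting it raises the height of all tree vertices that remain. So `U` is σ-dispersed inside each
given `K(X, ω)`.

σ-dispersedness is local (`sigmaDispersed_of_local`): if `U` is not σ-dispersed, nested components
`D 0 ⊇ D 1 ⊇ …`, each left by a finite set, can be chosen so that `U` is σ-dispersed in none of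
them, with finite connected sets joining points `p n ∈ D n` into a necklace. Locality at the end of
this necklace makes `U` σ-dispersed in a component of `D n` minus at most `k` points that contains
`p n` and `p (n + 1)`. This is excluded by choosing `D (n + 1)` disjoint from a maximal component of
that kind at `p n`, for each relevant `k ≤ n`; the maximal ones exist by Zorn's lemma
(`isSmallPiece_sUnion`).

σ-dispersed sets lie in normal trees (`SigmaDispersed.exists_isNormalTree`): a vertex is picked in
the current connected domain, deleted, and the construction continues in every remaining component.
Bookkeeping alternates between two aims: using up the finite connected sets that link successive
vertices, so that every branch yields a necklace, and using up the dispersed sets covering `U`, so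
that every point of `U` is picked after finitely many steps. -/

theorem conn_of_mem_bonds {F : Set α} (hF : F ∈ C.bonds) : C.Conn F :=
  fun _ hx _ hy => ⟨F, hF, subset_rfl, hx, hy⟩

theorem conn_biUnion_Icc {E : ℕ → Set α} (hE : ∀ n, C.Conn (E n))
    (h : ∀ n, (E n ∩ E (n + 1)).Nonempty) (a k : ℕ) :
    C.Conn (⋃ i ∈ Set.Icc a (a + k), E i) := by
  induction k with
  | zero => simpa using hE a
  | succ k ih =>
    have : (⋃ i ∈ Set.Icc a (a + (k + 1)), E i) =
        (⋃ i ∈ Set.Icc a (a + k), E i) ∪ E (a + k + 1) := by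
      have h1 : Set.Icc a (a + (k + 1)) = insert (a + k + 1) (Set.Icc a (a + k)) := by
        ext i
        simp only [Set.mem_Icc, Set.mem_insert_iff]
        omega
      rw [h1, Set.biUnion_insert, Set.union_comm]
    rw [this]
    refine ih.union (hE _) ?_
    obtain ⟨x, hx, hx'⟩ := h (a + k)
    exact ⟨x, Set.mem_biUnion (Set.mem_Icc.2 ⟨by omega, le_rfl⟩) hx, hx'⟩

theorem conn_iUnion_of_inter_succ {E : ℕ → Set α} (hE : ∀ n, C.Conn (E n))
    (h : ∀ n, (E n ∩ E (n + 1)).Nonempty) : C.Conn (⋃ n, E n) := by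
  intro x hx y hy
  obtain ⟨i, hi⟩ := Set.mem_iUnion.1 hx
  obtain ⟨j, hj⟩ := Set.mem_iUnion.1 hy
  obtain ⟨F, hF, h1, h2⟩ := conn_biUnion_Icc hE h 0 (max i j) x
    (Set.mem_biUnion (Set.mem_Icc.2 ⟨by omega, by omega⟩) hi) y
    (Set.mem_biUnion (Set.mem_Icc.2 ⟨by omega, by omega⟩) hj)
  exact ⟨F, hF, h1.trans (Set.iUnion₂_subset_iUnion _ _), h2⟩

/-- A locally finite sequence of finite connected sets, consecutive ones of which meet, covers a
necklace. -/
theorem isNecklace_iUnion {E : ℕ → Set α} (hfin : ∀ n, (E n).Finite) (hE : ∀ n, C.Conn (E n))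
    (h : ∀ n, (E n ∩ E (n + 1)).Nonempty)
    (hloc : ∀ n, ∃ m, ∀ j, m ≤ j → Disjoint (E n) (E j)) : C.IsNecklace (⋃ n, E n) := by
  choose f hf using hloc
  let g : ℕ → ℕ := fun n => (n + 1) + ∑ i ∈ Finset.range (n + 1), f i
  have hg1 : ∀ n, n < g n := fun n => by simp only [g]; omega
  have hg2 : ∀ n i j, i ≤ n → g n ≤ j → Disjoint (E i) (E j) := by
    intro n i j hi hj
    refine hf i j (le_trans ?_ hj)
    have := Finset.single_le_sum (f := f) (fun _ _ => Nat.zero_le _)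
      (Finset.mem_range.2 (show i < n + 1 by omega))
    simp only [g]
    omega
  -- The sets with indices from `b k` to `b (k + 1)`, both included, are merged into one bead.
  -- Neighbouring beads share `E (b (k + 1))`; beads at distance two or more are disjoint by `hg2`.
  let b : ℕ → ℕ := fun k => g^[k] 0
  have hb : ∀ k, b (k + 1) = g (b k) := fun k => Function.iterate_succ_apply' g k 0
  have hmono : StrictMono b := strictMono_nat_of_lt_succ fun k => by rw [hb]; exact hg1 _
  have hcover : ∀ n, ∃ k, b k ≤ n ∧ n ≤ b (k + 1) := by
    intro n
    induction n with
    | zero => exact ⟨0, le_rfl, Nat.zero_le _⟩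
    | succ n ih =>
      obtain ⟨k, h1, h2⟩ := ih
      rcases h2.lt_or_eq with h3 | h3
      · exact ⟨k, by omega, h3⟩
      · have := hmono (Nat.lt_succ_self (k + 1))
        exact ⟨k + 1, by omega, by simp only [Nat.succ_eq_add_one] at this; omega⟩
  have hne : ∀ n, (E n).Nonempty := fun n => (h n).mono Set.inter_subset_left
  refine ⟨conn_iUnion_of_inter_succ hE h, fun k => ⋃ i ∈ Set.Icc (b k) (b (k + 1)), E i,
    fun k => ⟨(Set.finite_Icc _ _).biUnion fun i _ => hfin i, ?_⟩, ?_, ?_⟩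
  · have := conn_biUnion_Icc hE h (b k) (b (k + 1) - b k)
    rwa [Nat.add_sub_cancel' (hmono (Nat.lt_succ_self k)).le] at this
  · refine subset_antisymm (Set.iUnion_subset fun n => ?_)
      (Set.iUnion_subset fun k => Set.iUnion₂_subset_iUnion _ _)
    obtain ⟨k, h1, h2⟩ := hcover n
    exact (Set.subset_biUnion_of_mem (u := E) (Set.mem_Icc.2 ⟨h1, h2⟩)).trans
      (Set.subset_iUnion (fun k => ⋃ i ∈ Set.Icc (b k) (b (k + 1)), E i) k)
  · have hdisj : ∀ i j, i + 2 ≤ j → ¬ ((⋃ s ∈ Set.Icc (b i) (b (i + 1)), E s) ∩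
        ⋃ s ∈ Set.Icc (b j) (b (j + 1)), E s).Nonempty := by
      rintro i j hij ⟨x, hx, hx'⟩
      simp only [Set.mem_iUnion, Set.mem_Icc, exists_prop] at hx hx'
      obtain ⟨s, hs, hxs⟩ := hx
      obtain ⟨t, ht, hxt⟩ := hx'
      refine Set.disjoint_left.1 (hg2 (b (i + 1)) s t hs.2 ?_) hxs hxt
      rw [← hb]
      exact (hmono.monotone hij).trans ht.1
    have hmeet : ∀ i j, i ≤ j → j ≤ i + 1 → ((⋃ s ∈ Set.Icc (b i) (b (i + 1)), E s) ∩
        ⋃ s ∈ Set.Icc (b j) (b (j + 1)), E s).Nonempty := by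
      intro i j h1 h2
      obtain ⟨x, hx⟩ := hne (b j)
      exact ⟨x, Set.mem_biUnion (Set.mem_Icc.2 ⟨hmono.monotone h1, hmono.monotone h2⟩) hx,
        Set.mem_biUnion (Set.mem_Icc.2 ⟨le_rfl, (hmono (Nat.lt_succ_self j)).le⟩) hx⟩
    intro i j
    rw [abs_le]
    constructor
    · intro hn
      by_contra hcon
      rcases le_total i j with hij | hij
      · exact hdisj i j (by omega) hn
      · rw [Set.inter_comm] at hn
        exact hdisj j i (by omega) hn
    · intro hn
      rcases le_total i j with hij | hij
      · exact hmeet i j hij (by omega)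
      · rw [Set.inter_comm]
        exact hmeet j i hij (by omega)

theorem exists_component_mem {Y : Set α} (hY : Y ⊆ C.ground) {x : α} (hx : x ∈ Y) :
    ∃ K, C.IsComponent Y K ∧ x ∈ K := by
  obtain ⟨K, hK, hxK⟩ := exists_component (conn_of_mem_bonds (C.singleton_mem x (hY hx)))
    (Set.singleton_subset_iff.2 hx) (Set.singleton_nonempty x)
  exact ⟨K, hK, hxK rfl⟩

theorem IsComponent.of_subset {Y Y' K : Set α} (hK : C.IsComponent Y K) (hY : Y' ⊆ Y)
    (h : K ⊆ Y') : C.IsComponent Y' K :=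
  ⟨⟨h, hK.1.2⟩, fun _ hB hle => hK.2 ⟨hB.1.trans hY, hB.2⟩ hle⟩

/-- Nonemptiness matters: if `D ⊆ Z`, the empty set is a component of `D \ Z` but need not be
maximal in `Y \ Z`. -/
theorem IsComponent.trans {Y D Z K : Set α} (hD : C.IsComponent Y D)
    (hK : C.IsComponent (D \ Z) K) (hne : K.Nonempty) : C.IsComponent (Y \ Z) K := by
  refine ⟨⟨hK.1.1.trans (Set.sdiff_subset_sdiff_left hD.1.1), hK.1.2⟩, fun B hB hle => ?_⟩
  obtain ⟨x, hx⟩ := hne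
  have h1 : B ⊆ D := hD.subset_of_conn hB.2 (hB.1.trans Set.sdiff_subset)
    ⟨x, hle hx, (hK.1.1 hx).1⟩
  exact hK.2 ⟨fun y hy => ⟨h1 hy, (hB.1 hy).2⟩, hB.2⟩ hle

theorem IsNecklace.exists_component {N X : Set α} (hN : C.IsNecklace N) (hX : X.Finite) :
    ∃ K, C.IsComponent (C.ground \ X) K ∧ (N \ K).Finite := by
  obtain ⟨M, hM, hMN, hfin⟩ := hN.exists_sub hX.toFinset
  rw [hX.coe_toFinset] at hMN
  obtain ⟨K, hK, hMK⟩ := Connectoid.exists_component (Y := C.ground \ X) hM.1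
    (fun x hx => ⟨hM.1.subset_ground hx, (hMN hx).2⟩) hM.infinite.nonempty
  exact ⟨K, hK, hfin.subset (Set.sdiff_subset_sdiff_right hMK)⟩

theorem IsNecklace.inter_nonempty {N A B : Set α} (hN : C.IsNecklace N) (hA : (N \ A).Finite)
    (hB : (N \ B).Finite) : (A ∩ B).Nonempty := by
  by_contra h
  refine hN.infinite ((hA.union hB).subset fun x hx => ?_)
  by_cases hxA : x ∈ A
  · exact Or.inr ⟨hx, fun hxB => h ⟨x, hxA, hxB⟩⟩
  · exact Or.inl ⟨hx, hxA⟩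

/-- A component of `S \ (X ∪ X')` that contains almost all of a necklace lies in any component
of `S \ X` that does so. -/
theorem IsNecklace.component_subset {N Y Y' K K' : Set α} (hN : C.IsNecklace N)
    (hK : C.IsComponent Y K) (hK' : C.IsComponent Y' K') (hY : Y' ⊆ Y) (hNK : (N \ K).Finite)
    (hNK' : (N \ K').Finite) : K' ⊆ K :=
  hK.subset_of_conn hK'.1.2 (hK'.1.1.trans hY) (hN.inter_nonempty hNK' hNK)

/-! ### Dispersed and σ-dispersed sets. -/

variable (C)

/-- A set is dispersed if every necklace is separated from it by a finite set. -/
def Dispersed (A : Set α) : Prop :=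
  ∀ N, C.IsNecklace N → ∃ X : Set α, X.Finite ∧ ∃ K, C.IsComponent (C.ground \ X) K ∧
    (N \ K).Finite ∧ Disjoint K A

/-- A set is `σ`-dispersed if countably many dispersed sets cover it. -/
def SigmaDispersed (A : Set α) : Prop :=
  ∃ L : ℕ → Set α, (∀ n, C.Dispersed (L n)) ∧ A ⊆ ⋃ n, L n

variable {C}

theorem Dispersed.mono {A B : Set α} (hB : C.Dispersed B) (h : A ⊆ B) : C.Dispersed A := by
  intro N hN
  obtain ⟨X, hX, K, hK, h1, h2⟩ := hB N hN
  exact ⟨X, hX, K, hK, h1, h2.mono_right h⟩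

theorem dispersed_of_finite {A : Set α} (hA : A.Finite) : C.Dispersed A := by
  intro N hN
  obtain ⟨K, hK, h1⟩ := hN.exists_component hA
  exact ⟨A, hA, K, hK, h1, Set.disjoint_left.2 fun x hx => (hK.1.1 hx).2⟩

theorem Dispersed.sigmaDispersed {A : Set α} (hA : C.Dispersed A) : C.SigmaDispersed A :=
  ⟨fun _ => A, fun _ => hA, Set.subset_iUnion (fun _ : ℕ => A) 0⟩

theorem SigmaDispersed.mono {A B : Set α} (hB : C.SigmaDispersed B) (h : A ⊆ B) :
    C.SigmaDispersed A := by
  obtain ⟨L, hL, hB⟩ := hB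
  exact ⟨L, hL, h.trans hB⟩

theorem sigmaDispersed_iUnion {A : ℕ → Set α} (hA : ∀ n, C.SigmaDispersed (A n)) :
    C.SigmaDispersed (⋃ n, A n) := by
  choose L hL hA using hA
  refine ⟨fun k => L k.unpair.1 k.unpair.2, fun k => hL _ _, Set.iUnion_subset fun n x hx => ?_⟩
  obtain ⟨m, hm⟩ := Set.mem_iUnion.1 (hA n hx)
  exact Set.mem_iUnion.2 ⟨Nat.pair n m, by simpa using hm⟩

theorem SigmaDispersed.union {A B : Set α} (hA : C.SigmaDispersed A) (hB : C.SigmaDispersed B) :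
    C.SigmaDispersed (A ∪ B) := by
  have := sigmaDispersed_iUnion (C := C) (A := fun n => if n = 0 then A else B)
    (fun n => by split_ifs <;> assumption)
  refine this.mono (Set.union_subset (fun x hx => Set.mem_iUnion.2 ⟨0, by simpa using hx⟩)
    (fun x hx => Set.mem_iUnion.2 ⟨1, by simpa using hx⟩))

/-- Being `σ`-dispersed can be checked on the components left by a finite set. -/
theorem sigmaDispersed_of_components {U D X Z : Set α} (hX : X.Finite)
    (hD : C.IsComponent (C.ground \ X) D) (hZ : Z.Finite)
    (h : ∀ K, C.IsComponent (D \ Z) K → C.SigmaDispersed (U ∩ K)) :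
    C.SigmaDispersed (U ∩ D) := by
  choose! L hL hUL using h
  -- There may be uncountably many components, so their `n`-th dispersed sets are merged into one.
  -- The union stays dispersed because almost all of a necklace lies in a single component of `S \
  -- (X ∪ Z)`, which either misses `D` or is one of these components, where only one `L K n`
  -- matters.
  have hdisp : ∀ n, C.Dispersed (⋃ K ∈ {K | C.IsComponent (D \ Z) K}, L K n ∩ K) := by
    intro n N hN
    obtain ⟨K₁, hK₁, hN₁⟩ := hN.exists_component (hX.union hZ)
    by_cases hmeet : (K₁ ∩ D).Nonempty
    · have hsub : K₁ ⊆ D := hD.subset_of_conn hK₁.1.2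
        (hK₁.1.1.trans (Set.sdiff_subset_sdiff_right Set.subset_union_left)) hmeet
      have hcomp : C.IsComponent (D \ Z) K₁ := by
        refine hK₁.of_subset ?_ fun x hx => ⟨hsub hx, fun hz => (hK₁.1.1 hx).2 (Or.inr hz)⟩
        intro x hx
        exact ⟨(hD.1.1 hx.1).1, fun hxx => hxx.elim (hD.1.1 hx.1).2 hx.2⟩
      obtain ⟨X₂, hX₂, K₂, hK₂, hN₂, hdis⟩ := hL K₁ hcomp n N hN
      obtain ⟨K₃, hK₃, hN₃⟩ := hN.exists_component ((hX.union hZ).union hX₂)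
      have h31 := hN.component_subset hK₁ hK₃
        (Set.sdiff_subset_sdiff_right Set.subset_union_left) hN₁ hN₃
      have h32 := hN.component_subset hK₂ hK₃
        (Set.sdiff_subset_sdiff_right Set.subset_union_right) hN₂ hN₃
      refine ⟨_, (hX.union hZ).union hX₂, K₃, hK₃, hN₃, Set.disjoint_left.2 fun x hx hx' => ?_⟩
      simp only [Set.mem_iUnion, Set.mem_ofPred_eq, exists_prop] at hx'
      obtain ⟨K, hK, hxL, hxK⟩ := hx'
      obtain rfl := hK.eq_of_inter hcomp ⟨x, hxK, h31 hx⟩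
      exact Set.disjoint_left.1 hdis (h32 hx) hxL
    · refine ⟨_, hX.union hZ, K₁, hK₁, hN₁, Set.disjoint_left.2 fun x hx hx' => hmeet ⟨x, hx, ?_⟩⟩
      simp only [Set.mem_iUnion, Set.mem_ofPred_eq, exists_prop] at hx'
      obtain ⟨K, hK, -, hxK⟩ := hx'
      exact (hK.1.1 hxK).1
  refine ((dispersed_of_finite hZ).sigmaDispersed.union
    (show C.SigmaDispersed (⋃ n, _) from ⟨_, hdisp, subset_rfl⟩)).mono ?_
  rintro x ⟨hxU, hxD⟩
  by_cases hxZ : x ∈ Z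
  · exact Or.inl hxZ
  · obtain ⟨K, hK, hxK⟩ := exists_component_mem (C := C) (Y := D \ Z)
      (fun y hy => (hD.1.1 hy.1).1) ⟨hxD, hxZ⟩
    obtain ⟨n, hn⟩ := Set.mem_iUnion.1 (hUL K hK ⟨hxU, hxK⟩)
    exact Or.inr (Set.mem_iUnion.2 ⟨n, Set.mem_biUnion (show K ∈ {K | _} from hK) ⟨hn, hxK⟩⟩)

/-- The component `K(X, ω)` contains almost all of every necklace of `ω`. -/
theorem Necklace.diff_endComponent_finite (N : C.Necklace) (X : Finset α) :
    (N.1 \ C.endComponent X (Quotient.mk C.necklaceSetoid N)).Finite := by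
  obtain ⟨hK, P, hP, hPK⟩ := C.endComponent_spec X (Quotient.mk C.necklaceSetoid N)
  obtain ⟨L, hL, h1, h2⟩ := (show Necklace.Equivalent P N from Quotient.exact hP) X
  obtain ⟨x, hx⟩ := (P.tail_spec X).2.nonempty
  rw [hK.eq_of_inter hL ⟨x, P.tail_subset hPK hx, h1 hx⟩]
  obtain ⟨M, hM, hMN, hfin⟩ := N.2.exists_sub X
  obtain ⟨A, hA, hMA⟩ := Connectoid.exists_component hM.1 hMN hM.infinite.nonempty
  have : A = N.tail X :=
    (N.2.existsUnique_tail X).unique ⟨hA, hM.infinite.mono hMA⟩ (N.tail_spec X)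
  exact hfin.subset (Set.sdiff_subset_sdiff_right ((hMA.trans this.le).trans h2))

theorem IsConnected.isComponent_ground (hC : C.IsConnected) :
    C.IsComponent (C.ground \ ∅) C.ground :=
  ⟨⟨by simp, hC⟩, fun _ hB _ => hB.1.trans Set.sdiff_subset⟩

end Connectoid

/-! ### The levels of a normal tree are dispersed. -/

namespace RootedGraphTree

variable {α : Type*} (T : RootedGraphTree α)

open Classical in
/-- The height of a vertex: the length of the path from the root to it. -/
noncomputable def height (v : α) : ℕ :=
  if h : v ∈ T.graph.verts then
    (T.isTree.existsUnique_path ⟨T.root, T.root_mem⟩ ⟨v, h⟩).choose.length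
  else 0

variable {T}

theorem height_eq {v : α} (hv : v ∈ T.graph.verts)
    {p : T.graph.coe.Walk ⟨T.root, T.root_mem⟩ ⟨v, hv⟩} (hp : p.IsPath) :
    T.height v = p.length := by
  rw [height, dif_pos hv]
  congr 1
  exact (T.isTree.existsUnique_path _ _).unique
    (T.isTree.existsUnique_path ⟨T.root, T.root_mem⟩ ⟨v, hv⟩).choose_spec.1 hp

theorem height_lt {u v : α} (h : T.le u v) (hne : u ≠ v) : T.height u < T.height v := by
  classical
  obtain ⟨hu, hv, p, hp, hmem⟩ := h
  rw [height_eq hv hp, height_eq hu (hp.takeUntil hmem)]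
  exact p.length_takeUntil_lt_length hmem fun h => hne (congrArg Subtype.val h)

end RootedGraphTree

namespace Connectoid

variable {α : Type*} {C : Connectoid α}

/-- A connected set that meets a weak normal tree has a least tree vertex. -/
theorem IsWeakNormalTree.exists_min {T : RootedGraphTree α} (hT : C.IsWeakNormalTree T)
    {A : Set α} (hA : C.Conn A) (hne : (A ∩ T.verts).Nonempty) :
    ∃ u ∈ A ∩ T.verts, ∀ v ∈ A ∩ T.verts, T.le u v := by
  obtain ⟨u, hu, hmin⟩ := (measure T.height).wf.has_min _ hne
  refine ⟨u, hu, fun v hv => ?_⟩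
  by_contra hcon
  by_cases hvu : T.le v u
  · by_cases h : v = u
    · subst h
      exact hcon hvu
    · exact hmin v hv (RootedGraphTree.height_lt hvu h)
  · obtain ⟨w, hw, hwu, hwv⟩ := hT.incomparable A hA u hu v hv hcon hvu
    have hwT : w ∈ A ∩ T.verts := ⟨hw, hwu.1⟩
    by_cases h : w = u
    · exact hcon (h ▸ hwv)
    · exact hmin w hwT (RootedGraphTree.height_lt hwu h)

/-- The vertex set of a weak normal tree of a component left by a finite set is `σ`-dispersed: the
levels of the tree are dispersed. -/
theorem IsWeakNormalTree.sigmaDispersed {X K : Set α} (hX : X.Finite)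
    (hK : C.IsComponent (C.ground \ X) K) {T : RootedGraphTree α}
    (hT : (C.induce K).IsWeakNormalTree T) : C.SigmaDispersed T.verts := by
  have hTK : T.verts ⊆ K := fun x hx => (hT.verts_subset hx).2
  refine ⟨fun m => {v | v ∈ T.verts ∧ T.height v < m}, fun m N hN => ?_,
    fun v hv => Set.mem_iUnion.2 ⟨T.height v + 1, hv, Nat.lt_succ_self _⟩⟩
  obtain ⟨K₀, hK₀, hN₀⟩ := hN.exists_component hX
  by_cases hKK : (K₀ ∩ K).Nonempty
  swap
  · exact ⟨X, hX, K₀, hK₀, hN₀, Set.disjoint_left.2 fun x hx hx' => hKK ⟨x, hx, hTK hx'.1⟩⟩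
  obtain rfl := hK₀.eq_of_inter hK hKK
  induction m with
  | zero => exact ⟨X, hX, K₀, hK₀, hN₀, Set.disjoint_left.2 fun x _ hx => by simp at hx⟩
  | succ m ih =>
    obtain ⟨X₁, hX₁, A, hA, hNA, hdisj⟩ := ih
    obtain ⟨B, hB, hNB⟩ := hN.exists_component (hX.union hX₁)
    have hBK := hN.component_subset hK hB
      (Set.sdiff_subset_sdiff_right Set.subset_union_left) hN₀ hNB
    have hBA := hN.component_subset hA hB
      (Set.sdiff_subset_sdiff_right Set.subset_union_right) hNA hNB
    by_cases hne : (B ∩ T.verts).Nonempty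
    swap
    · exact ⟨_, hX.union hX₁, B, hB, hNB, Set.disjoint_left.2 fun x hx hx' => hne ⟨x, hx, hx'.1⟩⟩
    -- `B` avoids the tree vertices of height below `m`, so its least tree vertex `u` has height at
    -- least `m`. All other tree vertices in `B` lie strictly above `u`; deleting the single point
    -- `u` therefore clears height `m` as well.
    obtain ⟨u, hu, hmin⟩ := hT.exists_min ((conn_induce_iff _ _ _).2 ⟨hB.1.2, hBK⟩) hne
    have hum : m ≤ T.height u := by
      by_contra hcon
      exact Set.disjoint_left.1 hdisj (hBA hu.1) ⟨hu.2, not_le.1 hcon⟩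
    obtain ⟨B', hB', hNB'⟩ := hN.exists_component ((hX.union hX₁).union (Set.finite_singleton u))
    have hBB := hN.component_subset hB hB'
      (Set.sdiff_subset_sdiff_right Set.subset_union_left) hNB hNB'
    refine ⟨_, (hX.union hX₁).union (Set.finite_singleton u), B', hB', hNB',
      Set.disjoint_left.2 fun x hx hx' => ?_⟩
    have hxu : u ≠ x := by
      rintro rfl
      exact (hB'.1.1 hx).2 (Or.inr rfl)
    have h1 := RootedGraphTree.height_lt (hmin x ⟨hBB hx, hx'.1⟩) hxu
    have h2 := hx'.2
    omega

end Connectoid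

/-! ### From local to global σ-dispersedness. -/

namespace Connectoid

variable {α : Type*} {C : Connectoid α}

variable (C) in
/-- Components `K ∋ p` of `D` minus at most `k` points for which `U ∩ K` is `σ`-dispersed. -/
def IsSmallPiece (U D : Set α) (p : α) (k : ℕ) (K : Set α) : Prop :=
  p ∈ K ∧ C.SigmaDispersed (U ∩ K) ∧ ∃ Z : Set α, Z.encard ≤ k ∧ C.IsComponent (D \ Z) K

/-- The chain step for Zorn's lemma. The union stays σ-dispersed because it is already the union of
countably many members of the chain, and it is again a component after deleting at most `k` points
because the deleted sets have an ultrafilter limit. -/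
theorem isSmallPiece_sUnion {U D : Set α} {p : α} {k : ℕ} {c : Set (Set α)}
    (hc : IsChain (· ⊆ ·) c) (hne : c.Nonempty) (h : ∀ K ∈ c, C.IsSmallPiece U D p k K) :
    C.IsSmallPiece U D p k (⋃₀ c) := by
  choose! hp hgood Z hZ hcomp using h
  have hdir : DirectedOn (· ⊆ ·) c := hc.directedOn
  have hconn : C.Conn (⋃₀ c) := conn_of_common_point (fun K hK => (hcomp K hK).1.2) hp
  have hD : ⋃₀ c ⊆ D := Set.sUnion_subset fun K hK => (hcomp K hK).1.1.trans Set.sdiff_subset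
  have hpc : p ∈ ⋃₀ c := by
    obtain ⟨K, hK⟩ := hne
    exact ⟨K, hK, hp K hK⟩
  refine ⟨hpc, ?_, ?_⟩
  -- Each next member of the sequence absorbs the points of `⋃₀ c` that were deleted for the
  -- previous one. Hence a point of the union is deleted at most once along the sequence, and a
  -- finite connected set joining `p` to `x` is eventually untouched by the deletions, so it lies in
  -- some `S n`.
  · have hnext : ∀ K : c, ∃ K' : c, K.1 ⊆ K'.1 ∧ Z K.1 ∩ ⋃₀ c ⊆ K'.1 := by
      intro K
      have hfin : (Z K.1 ∩ ⋃₀ c).Finite :=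
        (Set.finite_of_encard_le_coe (hZ K.1 K.2)).inter_of_left _
      obtain ⟨K', hK', hsub⟩ := hdir.exists_mem_subset_of_finite_of_subset_sUnion hne hfin
        Set.inter_subset_right
      obtain ⟨K'', hK'', h1, h2⟩ := hdir K.1 K.2 K' hK'
      exact ⟨⟨K'', hK''⟩, h1, hsub.trans h2⟩
    choose f hf1 hf2 using hnext
    obtain ⟨K₀, hK₀⟩ := hne
    let S : ℕ → c := fun n => f^[n] ⟨K₀, hK₀⟩
    have hS : ∀ n, S (n + 1) = f (S n) := fun n => Function.iterate_succ_apply' f n _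
    have hmono : Monotone fun n => (S n).1 := monotone_nat_of_le_succ fun n => by
      rw [hS]; exact hf1 _
    have hev : ∀ x ∈ ⋃₀ c, ∀ᶠ n in Filter.atTop, x ∉ Z (S n).1 := by
      intro x hx
      by_cases hex : ∃ n, x ∈ Z (S n).1
      · obtain ⟨n, hn⟩ := hex
        filter_upwards [Filter.eventually_ge_atTop (n + 1)] with m hm hxm
        have h1 : x ∈ (S (n + 1)).1 := by
          rw [hS]; exact hf2 _ ⟨hn, hx⟩
        exact ((hcomp _ (S m).2).1.1 (hmono hm h1)).2 hxm
      · exact Filter.Eventually.of_forall fun n hn => hex ⟨n, hn⟩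
    refine (sigmaDispersed_iUnion fun n => hgood _ (S n).2).mono ?_
    rintro x ⟨hxU, hx⟩
    obtain ⟨F, hF, hFc, hpF, hxF⟩ := hconn p hpc x hx
    obtain ⟨n, hn⟩ := ((C.finite_of_mem F hF).eventually_all.2 fun y hy => hev y (hFc hy)).exists
    have hFS : F ⊆ (S n).1 := (hcomp _ (S n).2).subset_of_conn (conn_of_mem_bonds hF)
      (fun y hy => ⟨hD (hFc hy), hn y hy⟩) ⟨p, hpF, hp _ (S n).2⟩
    exact Set.mem_iUnion.2 ⟨n, hxU, hFS hxF⟩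
  · have : Nonempty c := hne.to_subtype
    have : IsDirectedOrder c := ⟨fun A B => by
      obtain ⟨K, hK, h1, h2⟩ := hdir A.1 A.2 B.1 B.2
      exact ⟨⟨K, hK⟩, h1, h2⟩⟩
    -- The limit set consists of the points lying in `Z K` for `𝒰`-almost all `K`. Any `k + 1` of
    -- them would lie in a common `Z K`, so there are at most `k`; a finite set avoiding the limit
    -- avoids `Z K` for almost all `K`, which gives maximality.
    let 𝒰 : Ultrafilter c := Ultrafilter.of Filter.atTop
    have h𝒰 : (𝒰 : Filter c) ≤ Filter.atTop := Ultrafilter.of_le _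
    have hmem : ∀ K ∈ c, ∀ᶠ L : c in 𝒰, K ⊆ L.1 := fun K hK =>
      h𝒰 (Filter.eventually_ge_atTop (⟨K, hK⟩ : c))
    refine ⟨{y | ∀ᶠ K : c in 𝒰, y ∈ Z K.1}, ?_, ⟨fun x hx => ⟨hD hx, fun hxY => ?_⟩, hconn⟩, ?_⟩
    · by_contra hcon
      have hlt : ((k + 1 : ℕ) : ℕ∞) ≤ {y | ∀ᶠ K : c in 𝒰, y ∈ Z K.1}.encard := by
        rw [Nat.cast_add, Nat.cast_one]
        exact Order.add_one_le_of_lt (not_le.1 hcon)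
      obtain ⟨t, ht, hcard⟩ := Set.exists_subset_encard_eq hlt
      have htfin : t.Finite := Set.finite_of_encard_eq_coe hcard
      obtain ⟨K, hK⟩ := (htfin.eventually_all.2 fun y hy => ht hy).exists
      have := (Set.encard_le_encard (show t ⊆ Z K.1 from hK)).trans (hZ _ K.2)
      rw [hcard] at this
      have := ENat.natCast_le_natCast.1 this
      omega
    · obtain ⟨K, hK, hxK⟩ := hx
      obtain ⟨L, hL, hxL⟩ := ((hmem K hK).and hxY).exists
      exact ((hcomp _ L.2).1.1 (hL hxK)).2 hxL
    · intro B hB hle x hx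
      obtain ⟨F, hF, hFB, hpF, hxF⟩ := hB.2 p (hle hpc) x hx
      have hev : ∀ y ∈ F, ∀ᶠ K : c in 𝒰, y ∉ Z K.1 := fun y hy =>
        Ultrafilter.eventually_not.2 (hB.1 (hFB hy)).2
      obtain ⟨K, hK⟩ := ((C.finite_of_mem F hF).eventually_all.2 hev).exists
      exact ⟨K.1, K.2, (hcomp _ K.2).subset_of_conn (conn_of_mem_bonds hF)
        (fun y hy => ⟨(hB.1 (hFB hy)).1, hK y hy⟩) ⟨p, hpF, hp _ K.2⟩ hxF⟩

theorem exists_maximal_isSmallPiece {U D : Set α} {p : α} {k : ℕ}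
    (h : ∃ K, C.IsSmallPiece U D p k K) : ∃ K, Maximal (C.IsSmallPiece U D p k) K := by
  refine zorn_subset {K | C.IsSmallPiece U D p k K} fun c hcS hc => ?_
  rcases c.eq_empty_or_nonempty with rfl | hne
  · obtain ⟨K, hK⟩ := h
    exact ⟨K, hK, by simp⟩
  · exact ⟨⋃₀ c, isSmallPiece_sUnion hc hne hcS, fun s hs => Set.subset_sUnion_of_mem hs⟩

variable (C) in
/-- Components of `S` minus a finite set in which `U` fails to be `σ`-dispersed. -/
def IsBadPiece (U D : Set α) : Prop :=
  (∃ X : Set α, X.Finite ∧ C.IsComponent (C.ground \ X) D) ∧ ¬ C.SigmaDispersed (U ∩ D)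

theorem IsBadPiece.exists_component {U D Z : Set α} (hD : C.IsBadPiece U D) (hZ : Z.Finite) :
    ∃ D', C.IsComponent (D \ Z) D' ∧ C.IsBadPiece U D' := by
  obtain ⟨⟨X, hX, hcomp⟩, hbad⟩ := hD
  by_contra hcon
  push Not at hcon
  refine hbad (sigmaDispersed_of_components hX hcomp hZ fun K hK => ?_)
  rcases K.eq_empty_or_nonempty with rfl | hne
  · rw [Set.inter_empty]
    exact (dispersed_of_finite Set.finite_empty).sigmaDispersed
  · by_contra hbadK
    refine hcon K hK ⟨⟨X ∪ Z, hX.union hZ, ?_⟩, hbadK⟩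
    have := hcomp.trans hK hne
    rwa [Set.sdiff_sdiff] at this

theorem IsBadPiece.nonempty {U D : Set α} (hD : C.IsBadPiece U D) : D.Nonempty := by
  by_contra h
  rw [Set.not_nonempty_iff_eq_empty] at h
  refine hD.2 ?_
  rw [h, Set.inter_empty]
  exact (dispersed_of_finite Set.finite_empty).sigmaDispersed

/-- For each `k ≤ n` for which small pieces exist, a maximal one is cut off by deleting its own
finite separator: a bad piece in the rest that met it would lie inside it, where `U` is σ-dispersed.
Finitely many separators and `E` are deleted together, and a bad component remains. -/
theorem IsBadPiece.exists_next {U D E : Set α} {p : α} (hD : C.IsBadPiece U D) (hp : p ∈ D)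
    (hE : E.Finite) (n : ℕ) :
    ∃ D' p' E', C.IsBadPiece U D' ∧ p' ∈ D' ∧ E'.Finite ∧ C.Conn E' ∧ E' ⊆ D ∧ p ∈ E' ∧ p' ∈ E' ∧
      D' ⊆ D ∧ Disjoint E D' ∧ ∀ k ≤ n, (∃ K, C.IsSmallPiece U D p k K) →
        ∃ K, Maximal (C.IsSmallPiece U D p k) K ∧ Disjoint K D' := by
  have hZ : ∀ k, ∃ Z : Set α, Z.Finite ∧ ((∃ K, C.IsSmallPiece U D p k K) →
      ∃ K, Maximal (C.IsSmallPiece U D p k) K ∧ ∀ D', C.IsBadPiece U D' → C.Conn D' →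
        D' ⊆ D \ Z → Disjoint K D') := by
    intro k
    by_cases hex : ∃ K, C.IsSmallPiece U D p k K
    · obtain ⟨K, hK⟩ := exists_maximal_isSmallPiece hex
      obtain ⟨-, hgood, Z, hZ, hcomp⟩ := hK.1
      refine ⟨Z, Set.finite_of_encard_le_coe hZ, fun _ => ⟨K, hK, fun D' hbad hconn hsub => ?_⟩⟩
      by_contra hmeet
      rw [Set.not_disjoint_iff_nonempty_inter, Set.inter_comm] at hmeet
      exact hbad.2 (hgood.mono
        (Set.inter_subset_inter_right U (hcomp.subset_of_conn hconn hsub hmeet)))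
    · exact ⟨∅, Set.finite_empty, fun h => absurd h hex⟩
  choose Z hZfin hZ using hZ
  obtain ⟨D', hD', hbad⟩ := hD.exists_component
    (hE.union ((Set.finite_Iic n).biUnion fun k _ => hZfin k))
  obtain ⟨p', hp'⟩ := hbad.nonempty
  have hsub : D' ⊆ D := hD'.1.1.trans Set.sdiff_subset
  obtain ⟨⟨X, -, hcomp⟩, -⟩ := hD
  obtain ⟨F, hF, hFD, hpF, hpF'⟩ := hcomp.1.2 p hp p' (hsub hp')
  refine ⟨D', p', F, hbad, hp', C.finite_of_mem F hF, conn_of_mem_bonds hF, hFD, hpF, hpF', hsub,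
    Set.disjoint_left.2 fun x hx hx' => (hD'.1.1 hx').2 (Or.inl hx), fun k hk hex => ?_⟩
  obtain ⟨K, hK, hKD⟩ := hZ k hex
  exact ⟨K, hK, hKD D' hbad hD'.1.2 fun x hx => ⟨hsub hx, fun hxZ =>
    (hD'.1.1 hx).2 (Or.inr (Set.mem_biUnion (Set.mem_Iic.2 hk) hxZ))⟩⟩

/-- A set that is `σ`-dispersed locally at every end is `σ`-dispersed. -/
theorem sigmaDispersed_of_local (hC : C.IsConnected) {U : Set α} (hU : U ⊆ C.ground)
    (hloc : ∀ ω : C.Ends, ∃ X : Finset α, C.SigmaDispersed (U ∩ C.endComponent X ω)) :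
    C.SigmaDispersed U := by
  by_contra hcon
  have hbad₀ : C.IsBadPiece U C.ground := by
    refine ⟨⟨∅, Set.finite_empty, hC.isComponent_ground⟩, ?_⟩
    rwa [Set.inter_eq_left.2 hU]
  obtain ⟨p₀, hp₀⟩ := hbad₀.nonempty
  let State := {s : Set α × α × Set α // C.IsBadPiece U s.1 ∧ s.2.1 ∈ s.1 ∧ s.2.2.Finite}
  have hnext : ∀ (n : ℕ) (s : State), ∃ s' : State, C.Conn s'.1.2.2 ∧ s'.1.2.2 ⊆ s.1.1 ∧
      s.1.2.1 ∈ s'.1.2.2 ∧ s'.1.2.1 ∈ s'.1.2.2 ∧ s'.1.1 ⊆ s.1.1 ∧ Disjoint s.1.2.2 s'.1.1 ∧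
      ∀ k ≤ n, (∃ K, C.IsSmallPiece U s.1.1 s.1.2.1 k K) →
        ∃ K, Maximal (C.IsSmallPiece U s.1.1 s.1.2.1 k) K ∧ Disjoint K s'.1.1 := by
    rintro n ⟨⟨D, p, E⟩, hD, hp, hE⟩
    obtain ⟨D', p', E', h1, h2, h3, h⟩ := hD.exists_next hp hE n
    exact ⟨⟨⟨D', p', E'⟩, h1, h2, h3⟩, h⟩
  choose f hf using hnext
  let s : ℕ → State := fun n =>
    Nat.rec ⟨⟨C.ground, p₀, ∅⟩, hbad₀, hp₀, Set.finite_empty⟩ (fun n t => f n t) n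
  let D : ℕ → Set α := fun n => (s n).1.1
  let p : ℕ → α := fun n => (s n).1.2.1
  -- The link from `p n` to `p (n + 1)` is stored in state `n + 1`, so it is only the step to `D (n
  -- + 2)` that avoids it.
  let E : ℕ → Set α := fun n => (s (n + 1)).1.2.2
  have hbad : ∀ n, C.IsBadPiece U (D n) := fun n => (s n).2.1
  have hpD : ∀ n, p n ∈ D n := fun n => (s n).2.2.1
  have hEfin : ∀ n, (E n).Finite := fun n => (s (n + 1)).2.2.2
  have hEconn : ∀ n, C.Conn (E n) := fun n => (hf n (s n)).1
  have hED : ∀ n, E n ⊆ D n := fun n => (hf n (s n)).2.1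
  have hpE : ∀ n, p n ∈ E n := fun n => (hf n (s n)).2.2.1
  have hpE' : ∀ n, p (n + 1) ∈ E n := fun n => (hf n (s n)).2.2.2.1
  have hDD : ∀ n, D (n + 1) ⊆ D n := fun n => (hf n (s n)).2.2.2.2.1
  have hdisj : ∀ n, Disjoint (E n) (D (n + 2)) := fun n => (hf (n + 1) (s (n + 1))).2.2.2.2.2.1
  have hmax : ∀ n, ∀ k ≤ n, (∃ K, C.IsSmallPiece U (D n) (p n) k K) →
      ∃ K, Maximal (C.IsSmallPiece U (D n) (p n) k) K ∧ Disjoint K (D (n + 1)) :=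
    fun n => (hf n (s n)).2.2.2.2.2.2
  clear_value s
  have hanti : Antitone D := antitone_nat_of_succ_le hDD
  have hEE : ∀ i j, i + 2 ≤ j → Disjoint (E i) (E j) := fun i j hij =>
    (hdisj i).mono_right ((hED j).trans (hanti hij))
  have hneck : ∀ n, C.IsNecklace (⋃ m, E (n + m)) := fun n =>
    isNecklace_iUnion (fun _ => hEfin _) (fun _ => hEconn _)
      (fun m => ⟨p (n + m + 1), hpE' _, hpE _⟩)
      fun m => ⟨m + 2, fun j hj => hEE _ _ (by omega)⟩
  let N : C.Necklace := ⟨⋃ m, E (0 + m), hneck 0⟩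
  obtain ⟨X, hX⟩ := hloc (Quotient.mk C.necklaceSetoid N)
  have hNfin := N.diff_endComponent_finite X
  have hcomp := (C.endComponent_spec X (Quotient.mk C.necklaceSetoid N)).1
  set K := C.endComponent X (Quotient.mk C.necklaceSetoid N)
  let Z : Set α := {x | x ∈ X ∧ ∀ n, x ∈ D n}
  have hZfin : Z.Finite := X.finite_toSet.subset fun x hx => hx.1
  -- from some index on, `X` meets `D n` only in `Z` and misses `E n`
  have hev : ∀ x ∈ (X : Set α), ∀ᶠ n in Filter.atTop, (x ∈ D n → x ∈ Z) ∧ x ∉ E n := by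
    intro x hx
    refine Filter.Eventually.and ?_ ?_
    · by_cases hxD : ∀ n, x ∈ D n
      · exact Filter.Eventually.of_forall fun _ _ => ⟨hx, hxD⟩
      · push Not at hxD
        obtain ⟨m, hm⟩ := hxD
        filter_upwards [Filter.eventually_ge_atTop m] with n hn hxn
        exact absurd (hanti hn hxn) hm
    · by_cases hxE : ∃ n, x ∈ E n
      · obtain ⟨m, hm⟩ := hxE
        filter_upwards [Filter.eventually_ge_atTop (m + 2)] with n hn hxn
        exact Set.disjoint_left.1 (hEE m n hn) hm hxn
      · exact Filter.Eventually.of_forall fun n hn => hxE ⟨n, hn⟩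
  obtain ⟨n₀, hn₀⟩ := Filter.eventually_atTop.1 (X.finite_toSet.eventually_all.2 hev)
  let k := Z.ncard
  -- Beyond `n₀` the set `X` meets `D n` only in `Z` and misses the links; `k ≤ n` makes `hmax`
  -- available for `k = |Z|`.
  let n := max n₀ k
  have hPX : ∀ m x, x ∈ E (n + m) → x ∉ X := fun m x hx hxX =>
    (hn₀ (n + m) (le_trans (le_max_left _ _) (Nat.le_add_right _ _)) x hxX).2 hx
  have hPD : (⋃ m, E (n + m)) ⊆ D n \ Z := Set.iUnion_subset fun m x hx =>
    ⟨hanti (Nat.le_add_right n m) (hED _ hx), fun hxZ => hPX m x hx hxZ.1⟩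
  obtain ⟨L, hL, hPL⟩ := Connectoid.exists_component (hneck n).1 hPD (hneck n).infinite.nonempty
  have hDg : D n ⊆ C.ground := by
    obtain ⟨⟨Y, -, hY⟩, -⟩ := hbad n
    exact hY.1.1.trans Set.sdiff_subset
  have hPK : ((⋃ m, E (n + m)) ∩ K).Nonempty := by
    by_contra hcon
    refine (hneck n).infinite (hNfin.subset fun x hx => ⟨?_, fun hxK => hcon ⟨x, hx, hxK⟩⟩)
    obtain ⟨m, hm⟩ := Set.mem_iUnion.1 hx
    exact Set.mem_iUnion.2 ⟨n + m, by rwa [zero_add]⟩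
  have hLK : L ⊆ K := by
    refine hcomp.subset_of_conn hL.1.2 (fun x hx => ⟨hDg (hL.1.1 hx).1, fun hxX => ?_⟩)
      (hPK.mono (Set.inter_subset_inter_left K hPL))
    exact (hL.1.1 hx).2 ((hn₀ n (le_max_left _ _) x hxX).1 (hL.1.1 hx).1)
  have hpL : p n ∈ L := hPL (Set.mem_iUnion.2 ⟨0, hpE n⟩)
  have hpiece : C.IsSmallPiece U (D n) (p n) k L :=
    ⟨hpL, hX.mono (Set.inter_subset_inter_right U hLK), Z, hZfin.cast_ncard_eq.ge, hL⟩
  obtain ⟨M, hM, hMD⟩ := hmax n k (le_max_right _ _) ⟨L, hpiece⟩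
  obtain ⟨hpM, -, Z', -, hM'⟩ := hM.1
  -- `Z` lies in every `D m`, in particular in `D (n + 1)`, which `M` misses. So `M` avoids `Z` and
  -- lies in `L`; maximality then forces `p (n + 1) ∈ L ⊆ M`, although `p (n + 1) ∈ D (n + 1)`.
  have hML : M ⊆ L := hL.subset_of_conn hM'.1.2
    (fun x hx => ⟨(hM'.1.1 hx).1, fun hxZ => Set.disjoint_left.1 hMD hx (hxZ.2 _)⟩) ⟨_, hpM, hpL⟩
  exact Set.disjoint_left.1 hMD (hM.2 hpiece hML (hPL (Set.mem_iUnion.2 ⟨0, hpE' n⟩))) (hpD (n + 1))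

end Connectoid

/-! ### Rooted trees from ancestor functions. -/

/-- Data presenting a rooted tree with vertices in `α`: the height of each vertex `v` and the vertex
`anc v m` of height `m` below `v`. -/
structure AncestorSystem (α : Type*) where
  /-- the vertex set -/
  verts : Set α
  root : α
  /-- the distance from the root -/
  height : α → ℕ
  /-- the vertex of a given height below a vertex -/
  anc : α → ℕ → α
  root_mem : root ∈ verts
  anc_zero : ∀ v ∈ verts, anc v 0 = root
  anc_mem : ∀ v ∈ verts, ∀ m ≤ height v, anc v m ∈ verts
  height_anc : ∀ v ∈ verts, ∀ m ≤ height v, height (anc v m) = m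
  anc_height : ∀ v ∈ verts, anc v (height v) = v
  anc_anc : ∀ v ∈ verts, ∀ m ≤ height v, ∀ j ≤ m, anc (anc v m) j = anc v j

namespace AncestorSystem

variable {α : Type*} (A : AncestorSystem α)

theorem height_root : A.height A.root = 0 := by
  have := A.height_anc A.root A.root_mem 0 (Nat.zero_le _)
  rwa [A.anc_zero _ A.root_mem] at this

/-- `u` is the parent of `v`. -/
def IsParent (u v : α) : Prop := A.height v = A.height u + 1 ∧ A.anc v (A.height u) = u

/-- The graph in which every vertex other than the root is joined to its parent. -/
def graph : (⊤ : SimpleGraph α).Subgraph where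
  verts := A.verts
  Adj u v := u ∈ A.verts ∧ v ∈ A.verts ∧ (A.IsParent u v ∨ A.IsParent v u)
  adj_sub := by
    rintro u v ⟨-, -, h⟩
    rw [SimpleGraph.top_adj]
    rintro rfl
    rcases h with h | h <;> exact absurd h.1 (by omega)
  edge_vert h := h.1
  symm := ⟨fun _ _ h => ⟨h.2.1, h.1, h.2.2.symm⟩⟩

theorem IsParent.eq {A : AncestorSystem α} {u u' v : α} (h : A.IsParent u v)
    (h' : A.IsParent u' v) : u = u' := by
  have : A.height u = A.height u' := by have := h.1; have := h'.1; omega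
  rw [← h.2, this, h'.2]

theorem isParent_anc {v : α} (hv : v ∈ A.verts) {n : ℕ} (hn : n + 1 = A.height v) :
    A.IsParent (A.anc v n) v := by
  have := A.height_anc v hv n (by omega)
  exact ⟨by omega, by rw [this]⟩

theorem exists_isPath (n : ℕ) (v : α) (hv : v ∈ A.verts) (hn : A.height v = n) :
    ∃ p : A.graph.coe.Walk ⟨A.root, A.root_mem⟩ ⟨v, hv⟩, p.IsPath ∧
      ∀ x : A.graph.verts, x ∈ p.support ↔
        A.height x.1 ≤ A.height v ∧ A.anc v (A.height x.1) = x.1 := by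
  induction n generalizing v with
  | zero =>
    obtain rfl : v = A.root := by rw [← A.anc_height v hv, hn, A.anc_zero v hv]
    refine ⟨.nil, .nil, fun x => ?_⟩
    rw [SimpleGraph.Walk.support_nil, List.mem_singleton, hn, Nat.le_zero]
    constructor
    · rintro rfl
      exact ⟨hn, A.anc_height _ hv⟩
    · rintro ⟨h1, h2⟩
      rw [h1, A.anc_zero _ hv] at h2
      exact Subtype.ext h2.symm
  | succ n ih =>
    have hw := A.anc_mem v hv n (by omega)
    have hhw := A.height_anc v hv n (by omega)
    obtain ⟨p, hp, hsupp⟩ := ih (A.anc v n) hw hhw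
    have hadj : A.graph.coe.Adj ⟨A.anc v n, hw⟩ ⟨v, hv⟩ :=
      ⟨hw, hv, Or.inl (A.isParent_anc hv hn.symm)⟩
    refine ⟨p.concat hadj, hp.concat (fun hmem => ?_) hadj, fun x => ?_⟩
    · have := ((hsupp _).1 hmem).1
      simp only at this
      omega
    · rw [SimpleGraph.Walk.support_concat, List.mem_append,
        List.mem_singleton, hsupp, hhw]
      constructor
      · rintro (⟨h1, h2⟩ | rfl)
        · rw [A.anc_anc v hv n (by omega) _ h1] at h2
          exact ⟨by omega, h2⟩
        · exact ⟨le_rfl, A.anc_height v hv⟩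
      · rintro ⟨h1, h2⟩
        rcases h1.lt_or_eq with h3 | h3
        · refine Or.inl ⟨by omega, ?_⟩
          rwa [A.anc_anc v hv n (by omega) _ (by omega)]
        · rw [h3, A.anc_height v hv] at h2
          exact Or.inr (Subtype.ext h2.symm)

/-- A highest vertex of a cycle would have its two distinct cycle neighbours both as parents. -/
theorem isTree : A.graph.coe.IsTree := by
  classical
  refine ⟨(SimpleGraph.connected_iff_exists_forall_reachable _).2
    ⟨⟨A.root, A.root_mem⟩, fun v => ?_⟩, ?_⟩
  · obtain ⟨p, -⟩ := A.exists_isPath _ v.1 v.2 rfl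
    exact ⟨p⟩
  · intro v c hc
    obtain ⟨u, hu, hmax⟩ := c.support.toFinset.exists_max_image (fun x => A.height x.1)
      ⟨v, by simp⟩
    rw [List.mem_toFinset] at hu
    have hc' := hc.rotate hu
    have hle : ∀ x, x ∈ (c.rotate u hu).support → A.height x.1 ≤ A.height u.1 := fun x hx =>
      hmax x (List.mem_toFinset.2 ((SimpleGraph.Walk.mem_support_rotate_iff _ _ hu).1 hx))
    have hpar : ∀ x, A.graph.coe.Adj u x → x ∈ (c.rotate u hu).support →
        A.IsParent x.1 u.1 := by
      rintro x ⟨-, -, h | h⟩ hx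
      · have := h.1
        have := hle x hx
        omega
      · exact h
    have h1 := hpar _ (SimpleGraph.Walk.adj_snd hc'.not_nil)
      (SimpleGraph.Walk.getVert_mem_support _ _)
    have h2 := hpar _ (SimpleGraph.Walk.adj_penultimate hc'.not_nil).symm
      (SimpleGraph.Walk.getVert_mem_support _ _)
    exact hc'.snd_ne_penultimate (Subtype.ext (h1.eq h2))

/-- The rooted tree presented by an ancestor system. -/
def tree : RootedGraphTree α where
  graph := A.graph
  root := A.root
  root_mem := A.root_mem
  isTree := A.isTree

theorem le_iff {u v : α} : A.tree.le u v ↔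
    u ∈ A.verts ∧ v ∈ A.verts ∧ A.height u ≤ A.height v ∧ A.anc v (A.height u) = u := by
  constructor
  · rintro ⟨hu, hv, p, hp, hmem⟩
    obtain ⟨q, hq, hsupp⟩ := A.exists_isPath _ v hv rfl
    obtain rfl := (A.isTree.existsUnique_path _ _).unique hp hq
    exact ⟨hu, hv, (hsupp _).1 hmem⟩
  · rintro ⟨hu, hv, h⟩
    obtain ⟨q, hq, hsupp⟩ := A.exists_isPath _ v hv rfl
    exact ⟨hu, hv, q, hq, (hsupp ⟨u, hu⟩).2 h⟩

theorem isParent_of_isRootedRay {R : ℕ → α} (hR : A.tree.IsRootedRay R) (n : ℕ) :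
    A.IsParent (R n) (R (n + 1)) := by
  obtain ⟨h0, hinj, hadj⟩ := hR
  induction n with
  | zero =>
    refine (hadj 0).2.2.resolve_right fun h => ?_
    have h1 := h.1
    rw [h0] at h1
    have h2 : A.height A.tree.root = 0 := A.height_root
    omega
  | succ n ih =>
    refine (hadj (n + 1)).2.2.resolve_right fun h => ?_
    have := hinj (ih.eq h)
    omega

theorem height_of_isRootedRay {R : ℕ → α} (hR : A.tree.IsRootedRay R) (n : ℕ) :
    A.height (R n) = n := by
  induction n with
  | zero =>
    rw [hR.1]
    exact A.height_root
  | succ n ih => rw [(A.isParent_of_isRootedRay hR n).1, ih]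

end AncestorSystem

/-! ### Construction of a normal tree containing a σ-dispersed set. -/

namespace Connectoid

variable {α : Type*} {C : Connectoid α}

section ComponentOf

variable (C) in
/-- The component of `Y` that contains `u` (empty if `u ∉ Y`). -/
def componentOf (Y : Set α) (u : α) : Set α := ⋃₀ {B | B ⊆ Y ∧ C.Conn B ∧ u ∈ B}

theorem componentOf_subset (Y : Set α) (u : α) : C.componentOf Y u ⊆ Y :=
  Set.sUnion_subset fun _ hB => hB.1

theorem conn_componentOf (Y : Set α) (u : α) : C.Conn (C.componentOf Y u) :=
  conn_of_common_point (fun _ hB => hB.2.1) fun _ hB => hB.2.2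

theorem subset_componentOf {Y B : Set α} {u : α} (hB : B ⊆ Y) (hBc : C.Conn B) (hu : u ∈ B) :
    B ⊆ C.componentOf Y u :=
  Set.subset_sUnion_of_mem ⟨hB, hBc, hu⟩

theorem mem_componentOf {Y : Set α} (hY : Y ⊆ C.ground) {u : α} (hu : u ∈ Y) :
    u ∈ C.componentOf Y u :=
  subset_componentOf (Set.singleton_subset_iff.2 hu)
    (conn_of_mem_bonds (C.singleton_mem u (hY hu))) rfl rfl

theorem componentOf_eq {Y : Set α} {u v : α} (hv : v ∈ C.componentOf Y u) :
    C.componentOf Y v = C.componentOf Y u := by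
  have hu : u ∈ C.componentOf Y u := by
    obtain ⟨B, hB, -⟩ := hv
    exact ⟨B, hB, hB.2.2⟩
  have h1 := subset_componentOf (componentOf_subset Y u) (conn_componentOf Y u) hv
  exact (subset_componentOf (componentOf_subset Y v) (conn_componentOf Y v) (h1 hu)).antisymm h1

end ComponentOf

variable (C) in
/-- A finite connected subset of `D` containing `x` and `y`. -/
noncomputable def link (D : Set α) (x y : α) : Set α :=
  Classical.epsilon fun F => F ∈ C.bonds ∧ F ⊆ D ∧ x ∈ F ∧ y ∈ F

theorem link_spec {D : Set α} (hD : C.Conn D) {x y : α} (hx : x ∈ D) (hy : y ∈ D) :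
    C.link D x y ∈ C.bonds ∧ C.link D x y ⊆ D ∧ x ∈ C.link D x y ∧ y ∈ C.link D x y :=
  Classical.epsilon_spec (p := fun F => F ∈ C.bonds ∧ F ⊆ D ∧ x ∈ F ∧ y ∈ F) (hD x hx y hy)

section First

variable [Nonempty α]

/-- A point of `D` in the first of the sets `A 0, A 1, …` that meets `D`. -/
noncomputable def firstPoint (A : ℕ → Set α) (D : Set α) : α :=
  Classical.epsilon fun x => x ∈ D ∧ ∃ i, x ∈ A i ∧ ∀ j < i, ¬ (A j ∩ D).Nonempty

theorem firstPoint_spec {A : ℕ → Set α} {D : Set α} (h : ∃ i, (A i ∩ D).Nonempty) :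
    firstPoint A D ∈ D ∧ ∃ i, firstPoint A D ∈ A i ∧ ∀ j < i, ¬ (A j ∩ D).Nonempty := by
  classical
  obtain ⟨x, hxA, hxD⟩ := Nat.find_spec h
  exact Classical.epsilon_spec (p := fun x => x ∈ D ∧ ∃ i, x ∈ A i ∧ ∀ j < i, ¬ (A j ∩ D).Nonempty)
    ⟨x, hxD, Nat.find h, hxA, fun j hj => Nat.find_min h hj⟩

theorem firstPoint_mem {A : ℕ → Set α} {D : Set α} {i : ℕ} (h : (A i ∩ D).Nonempty)
    (hlt : ∀ j < i, ¬ (A j ∩ D).Nonempty) : firstPoint A D ∈ A i := by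
  obtain ⟨hD, i', hi', hlt'⟩ := firstPoint_spec ⟨i, h⟩
  rcases lt_trichotomy i' i with h1 | rfl | h1
  · exact absurd ⟨_, hi', hD⟩ (hlt i' h1)
  · exact hi'
  · exact absurd h (hlt' i h1)

open Classical in
/-- The choice of the next tree vertex in `D`: alternately from the sets `Q i` and `L i`. -/
noncomputable def nextVertex (L Q : ℕ → Set α) (n : ℕ) (D : Set α) : α :=
  if Even n ∧ ∃ i, (Q i ∩ D).Nonempty then firstPoint Q D else firstPoint L D

theorem nextVertex_mem {L Q : ℕ → Set α} {n : ℕ} {D : Set α} (h : ∃ i, (L i ∩ D).Nonempty) :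
    nextVertex L Q n D ∈ D := by
  unfold nextVertex
  split_ifs with h'
  · exact (firstPoint_spec h'.2).1
  · exact (firstPoint_spec h).1

end First

/-- A state of the construction of a normal tree: the part of the connectoid that is still to be
dealt with, its tree vertex, and the finite connected sets that are to be used up. -/
structure TreeState (α : Type*) where
  dom : Set α
  vertex : α
  queue : ℕ → Set α

namespace TreeState

variable [Nonempty α]

variable (C) in
/-- The initial state. -/
noncomputable def init (L : ℕ → Set α) : TreeState α :=
  ⟨C.ground, firstPoint L C.ground, fun _ => ∅⟩

variable (C) in
/-- The transition to the component containing `u`. -/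
noncomputable def step (L : ℕ → Set α) (n : ℕ) (s : TreeState α) (u : α) : TreeState α where
  dom := C.componentOf (s.dom \ {s.vertex}) u
  vertex := nextVertex L s.queue n (C.componentOf (s.dom \ {s.vertex}) u)
  queue := Function.update s.queue n
    (C.link s.dom s.vertex (nextVertex L s.queue n (C.componentOf (s.dom \ {s.vertex}) u)))

/-- The domain still meets one of the sets `L i`. -/
def Alive (L : ℕ → Set α) (s : TreeState α) : Prop := ∃ i, (L i ∩ s.dom).Nonempty

variable (C) in
/-- The states along an infinite branch of the tree. -/
structure IsRun (L : ℕ → Set α) (S : ℕ → TreeState α) : Prop where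
  zero : S 0 = init C L
  succ : ∀ n, ∃ u, S (n + 1) = step C L n (S n) u
  alive : ∀ n, Alive L (S n)

namespace IsRun

variable {L : ℕ → Set α} {S : ℕ → TreeState α}

theorem dom_succ (hS : IsRun C L S) (n : ℕ) :
    (S (n + 1)).dom ⊆ (S n).dom \ {(S n).vertex} := by
  obtain ⟨u, hu⟩ := hS.succ n
  rw [hu]
  exact componentOf_subset _ _

theorem antitone (hS : IsRun C L S) : Antitone fun n => (S n).dom :=
  antitone_nat_of_succ_le fun n => (hS.dom_succ n).trans Set.sdiff_subset

theorem vertex_mem (hS : IsRun C L S) (n : ℕ) : (S n).vertex ∈ (S n).dom := by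
  have ha := hS.alive n
  cases n with
  | zero =>
    rw [hS.zero] at ha ⊢
    exact (firstPoint_spec ha).1
  | succ n =>
    obtain ⟨u, hu⟩ := hS.succ n
    rw [hu] at ha ⊢
    exact nextVertex_mem ha

theorem vertex_injective (hS : IsRun C L S) : Function.Injective fun n => (S n).vertex := by
  have key : ∀ i j, i < j → (S i).vertex ≠ (S j).vertex := fun i j hij h =>
    (hS.dom_succ i (hS.antitone hij (hS.vertex_mem j))).2 h.symm
  intro i j hij
  rcases lt_trichotomy i j with h | h | h
  · exact absurd hij (key i j h)
  · exact h
  · exact absurd hij.symm (key j i h)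

theorem conn_dom (hC : C.IsConnected) (hS : IsRun C L S) (n : ℕ) : C.Conn (S n).dom := by
  cases n with
  | zero =>
    rw [hS.zero]
    exact hC
  | succ n =>
    obtain ⟨u, hu⟩ := hS.succ n
    rw [hu]
    exact conn_componentOf _ _

theorem queue_eq (hS : IsRun C L S) (i n : ℕ) (h : i < n) :
    (S n).queue i = C.link (S i).dom (S i).vertex (S (i + 1)).vertex := by
  induction n with
  | zero => omega
  | succ n ih =>
    obtain ⟨u, hu⟩ := hS.succ n
    rcases Nat.lt_succ_iff_lt_or_eq.1 h with h1 | rfl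
    · rw [hu]
      simp only [step]
      rw [Function.update_of_ne (by omega), ih h1]
    · rw [hu]
      simp only [step]
      rw [Function.update_self]

theorem vertex_succ (hS : IsRun C L S) (n : ℕ) :
    (S (n + 1)).vertex = nextVertex L (S n).queue n (S (n + 1)).dom := by
  obtain ⟨u, hu⟩ := hS.succ n
  rw [hu]
  rfl

theorem link_spec (hC : C.IsConnected) (hS : IsRun C L S) (n : ℕ) :
    C.link (S n).dom (S n).vertex (S (n + 1)).vertex ∈ C.bonds ∧
    C.link (S n).dom (S n).vertex (S (n + 1)).vertex ⊆ (S n).dom ∧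
    (S n).vertex ∈ C.link (S n).dom (S n).vertex (S (n + 1)).vertex ∧
    (S (n + 1)).vertex ∈ C.link (S n).dom (S n).vertex (S (n + 1)).vertex :=
  Connectoid.link_spec (hS.conn_dom hC n) (hS.vertex_mem n)
    (hS.antitone (Nat.le_succ n) (hS.vertex_mem (n + 1)))

/-- Suppose that the vertices of a run with indices `f k` are chosen in the first of the sets
`A i` that meets the domain, and that no `A i` contains almost all of these vertices. Then the
domains eventually miss each `A i`. -/
theorem eventually_missed (hS : IsRun C L S) {A : ℕ → Set α} (f : ℕ → ℕ) (hf : StrictMono f)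
    (hpick : ∀ i k, i < k → (A i ∩ (S (f k)).dom).Nonempty →
      (∀ j < i, ¬ (A j ∩ (S (f k)).dom).Nonempty) → (S (f k)).vertex ∈ A i)
    (hA : ∀ i m, ∃ k ≥ m, (S (f k)).vertex ∉ A i) (i : ℕ) :
    ∃ n, ¬ (A i ∩ (S n).dom).Nonempty := by
  induction i using Nat.strong_induction_on with
  | _ i ih =>
    by_contra hcon
    push Not at hcon
    have hev : ∀ j ∈ Set.Iio i, ∀ᶠ k in Filter.atTop, ¬ (A j ∩ (S (f k)).dom).Nonempty := by
      intro j hj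
      obtain ⟨n, hn⟩ := ih j hj
      filter_upwards [Filter.eventually_ge_atTop n] with k hk hne
      exact hn (hne.mono (Set.inter_subset_inter_right _ (hS.antitone (hk.trans (hf.id_le k)))))
    obtain ⟨m, hm⟩ := Filter.eventually_atTop.1 ((Set.finite_Iio i).eventually_all.2 hev)
    -- From `m` on, all earlier sets are missed. If `A i` still met every domain, each later choice
    -- would fall into it; the bound `i + 1` supplies `i < k` for `hpick`.
    obtain ⟨k, hk, hkA⟩ := hA i (max m (i + 1))
    exact hkA (hpick i k (by omega) (hcon _) (hm k (by omega)))

/-- Local finiteness is what the queue provides: a finite link cannot contain infinitely many of the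
distinct vertices, so the queue choices exhaust each link and the domains, hence all later links,
eventually avoid it. -/
theorem isNecklace (hC : C.IsConnected) (hS : IsRun C L S) :
    C.IsNecklace (⋃ n, C.link (S n).dom (S n).vertex (S (n + 1)).vertex) := by
  have hspec := hS.link_spec hC
  refine isNecklace_iUnion (fun n => C.finite_of_mem _ (hspec n).1)
    (fun n => conn_of_mem_bonds (hspec n).1)
    (fun n => ⟨_, (hspec n).2.2.2, (hspec (n + 1)).2.2.1⟩) fun n => ?_
  have hmiss : ∀ n, ∃ m, ¬ (C.link (S n).dom (S n).vertex (S (n + 1)).vertex ∩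
      (S m).dom).Nonempty := by
    -- Vertex `n + 1` is chosen with the parity of `n`, so the queue choices have odd index. At time
    -- `2 * k` the queue already holds every link with index at most `i < k`.
    refine hS.eventually_missed (fun k => 2 * k + 1) (fun a b h => by dsimp only; omega)
      (fun i k hik hne hlt => ?_) fun i m => ?_
    · have hq : ∀ j ≤ i, (S (2 * k)).queue j =
          C.link (S j).dom (S j).vertex (S (j + 1)).vertex :=
        fun j hj => hS.queue_eq j (2 * k) (by omega)
      rw [← hq i le_rfl] at hne
      rw [← hq i le_rfl, hS.vertex_succ (2 * k), nextVertex, if_pos ⟨even_two_mul k, i, hne⟩]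
      refine firstPoint_mem hne fun j hj => ?_
      rw [hq j hj.le]
      exact hlt j hj
    · by_contra hcon
      push Not at hcon
      refine Set.infinite_of_injective_forall_mem (f := fun k => (S (2 * (m + k) + 1)).vertex)
        (fun a b h => ?_) (fun k => hcon (m + k) (by omega)) (C.finite_of_mem _ (hspec i).1)
      have := hS.vertex_injective h
      omega
  obtain ⟨m, hm⟩ := hmiss n
  refine ⟨m, fun j hj => Set.disjoint_left.2 fun x hx hx' => hm ⟨x, hx, ?_⟩⟩
  exact hS.antitone hj ((hspec j).2.1 hx')

theorem vertex_mem_necklace (hC : C.IsConnected) (hS : IsRun C L S) (n : ℕ) :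
    (S n).vertex ∈ ⋃ n, C.link (S n).dom (S n).vertex (S (n + 1)).vertex :=
  Set.mem_iUnion.2 ⟨n, (hS.link_spec hC n).2.2.1⟩

/-- The links form a necklace through all vertices of the run, and a dispersed set is separated from
it by a finite set. So `L i` contains only finitely many vertices, and the choices from the sets `L
i` exhaust it. -/
theorem dispersed_missed (hC : C.IsConnected) (hS : IsRun C L S) (hL : ∀ i, C.Dispersed (L i))
    (i : ℕ) : ∃ n, ¬ (L i ∩ (S n).dom).Nonempty := by
  refine hS.eventually_missed (fun k => 2 * k + 1 + 1)
    (fun a b h => by dsimp only; omega) (fun i k _ hne hlt => ?_) (fun i m => ?_) i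
  · rw [hS.vertex_succ, nextVertex, if_neg fun h => by
      have := h.1
      rw [Nat.even_iff] at this
      omega]
    exact firstPoint_mem hne hlt
  · by_contra hcon
    push Not at hcon
    obtain ⟨X, -, K, -, hfin, hdisj⟩ := hL i _ (hS.isNecklace hC)
    refine Set.infinite_of_injective_forall_mem (f := fun k => (S (2 * (m + k) + 1 + 1)).vertex)
      (fun a b h => ?_) (fun k => ?_) hfin
    · have := hS.vertex_injective h
      omega
    · exact ⟨hS.vertex_mem_necklace hC _,
        fun hK => Set.disjoint_left.1 hdisj hK (hcon (m + k) (by omega))⟩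

end IsRun

variable (C) in
/-- The states on the way to the point `u`. -/
noncomputable def seq (L : ℕ → Set α) (u : α) : ℕ → TreeState α
  | 0 => init C L
  | n + 1 => step C L n (seq L u n) u

variable {L : ℕ → Set α}

theorem dom_seq_succ (u : α) (n : ℕ) :
    (seq C L u (n + 1)).dom ⊆ (seq C L u n).dom \ {(seq C L u n).vertex} :=
  componentOf_subset _ _

theorem antitone_dom_seq (u : α) : Antitone fun n => (seq C L u n).dom :=
  antitone_nat_of_succ_le fun n => (dom_seq_succ u n).trans Set.sdiff_subset

theorem dom_seq_subset_ground (u : α) (n : ℕ) : (seq C L u n).dom ⊆ C.ground :=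
  antitone_dom_seq u (Nat.zero_le n)

theorem conn_dom_seq (hC : C.IsConnected) (u : α) (n : ℕ) : C.Conn (seq C L u n).dom := by
  cases n with
  | zero => exact hC
  | succ n => exact conn_componentOf _ _

/-- Points that are still in a common domain have a common history. This is what makes the
separately defined sequences fit together into one tree. -/
theorem seq_eq {u v : α} {n : ℕ} (hv : v ∈ (seq C L u n).dom) : seq C L v n = seq C L u n := by
  induction n with
  | zero => rfl
  | succ n ih =>
    have h := ih (dom_seq_succ u n hv).1
    simp only [seq, step, h]
    rw [componentOf_eq (show v ∈ C.componentOf _ u from hv)]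

theorem vertex_mem_dom_seq {u : α} {n : ℕ} (h : Alive L (seq C L u n)) :
    (seq C L u n).vertex ∈ (seq C L u n).dom := by
  cases n with
  | zero => exact (firstPoint_spec h).1
  | succ n => exact nextVertex_mem h

variable (C) in
/-- The point `u` becomes a tree vertex in the `n`-th step. -/
structure Picked (L : ℕ → Set α) (u : α) (n : ℕ) : Prop where
  mem : u ∈ (seq C L u n).dom
  alive : Alive L (seq C L u n)
  eq : (seq C L u n).vertex = u

theorem Picked.alive_of_le {u : α} {m n : ℕ} (h : Picked C L u n) (hm : m ≤ n) :
    Alive L (seq C L u m) := by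
  obtain ⟨i, hi⟩ := h.alive
  exact ⟨i, hi.mono (Set.inter_subset_inter_right _ (antitone_dom_seq u hm))⟩

theorem Picked.vertex_mem {u : α} {m n : ℕ} (h : Picked C L u n) (hm : m ≤ n) :
    (seq C L u m).vertex ∈ (seq C L u m).dom :=
  vertex_mem_dom_seq (h.alive_of_le hm)

theorem Picked.vertex {u : α} {m n : ℕ} (h : Picked C L u n) (hm : m ≤ n) :
    Picked C L (seq C L u m).vertex m := by
  have heq := seq_eq (h.vertex_mem hm)
  exact ⟨by rw [heq]; exact h.vertex_mem hm, by rw [heq]; exact h.alive_of_le hm, by rw [heq]⟩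

theorem Picked.unique {u : α} {m n : ℕ} (h : Picked C L u n) (h' : Picked C L u m) : m = n := by
  have key : ∀ {i j}, Picked C L u i → Picked C L u j → ¬ i < j := fun hi hj hij =>
    (dom_seq_succ u _ (antitone_dom_seq u hij hj.mem)).2 hi.eq.symm
  have h1 := key h h'
  have h2 := key h' h
  omega

/-- Every point of the sets `L i` becomes a tree vertex. -/
theorem exists_picked (hC : C.IsConnected) (hL : ∀ i, C.Dispersed (L i)) {u : α} {i : ℕ}
    (hu : u ∈ L i) (hug : u ∈ C.ground) : ∃ n, Picked C L u n := by
  by_contra hcon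
  push Not at hcon
  have hmem : ∀ n, u ∈ (seq C L u n).dom := by
    intro n
    induction n with
    | zero => exact hug
    | succ n ih =>
      refine mem_componentOf (fun x hx => dom_seq_subset_ground u n hx.1) ⟨ih, fun h => ?_⟩
      exact hcon n ⟨ih, ⟨i, u, hu, ih⟩, h.symm⟩
  -- A point that is never picked stays in all domains, and as a member of `L i` it keeps the run
  -- alive forever, against `dispersed_missed`.
  have hrun : IsRun C L (seq C L u) :=
    ⟨rfl, fun n => ⟨u, rfl⟩, fun n => ⟨i, u, hu, hmem n⟩⟩
  obtain ⟨n, hn⟩ := hrun.dispersed_missed hC hL i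
  exact hn ⟨u, hu, hmem n⟩

/-- The infimum serves as a total height function; on tree vertices it is taken over a singleton. -/
theorem Picked.sInf_eq {u : α} {n : ℕ} (h : Picked C L u n) :
    sInf {n | Picked C L u n} = n :=
  h.unique (Nat.sInf_mem (s := {n | Picked C L u n}) ⟨n, h⟩)

variable (C) in
/-- The tree on the picked points. -/
noncomputable def ancestorSystem (L : ℕ → Set α) (h : Alive L (init C L)) : AncestorSystem α where
  verts := {u | ∃ n, Picked C L u n}
  root := (init C L).vertex
  height u := sInf {n | Picked C L u n}
  anc u m := (seq C L u m).vertex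
  root_mem := ⟨0, (firstPoint_spec h).1, h, rfl⟩
  anc_zero _ _ := rfl
  anc_mem := by
    rintro v ⟨n, hn⟩ m hm
    rw [hn.sInf_eq] at hm
    exact ⟨m, hn.vertex hm⟩
  height_anc := by
    rintro v ⟨n, hn⟩ m hm
    rw [hn.sInf_eq] at hm
    exact (hn.vertex hm).sInf_eq
  anc_height := by
    rintro v ⟨n, hn⟩
    rw [hn.sInf_eq]
    exact hn.eq
  anc_anc := by
    rintro v ⟨n, hn⟩ m hm j hj
    rw [hn.sInf_eq] at hm
    rw [seq_eq (antitone_dom_seq v hj (hn.vertex_mem hm))]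

theorem le_iff_of_picked (h : Alive L (init C L)) {u v : α} {m n : ℕ} (hu : Picked C L u m)
    (hv : Picked C L v n) :
    (ancestorSystem C L h).tree.le u v ↔ m ≤ n ∧ (seq C L v m).vertex = u := by
  rw [AncestorSystem.le_iff]
  simp only [ancestorSystem, hu.sInf_eq, hv.sInf_eq]
  exact ⟨fun h => h.2.2, fun h => ⟨⟨m, hu⟩, ⟨n, hv⟩, h⟩⟩

/-- The domain in which `u` is picked is connected, contains everything above `u`, and has lost all
vertices below `u`; this gives comparability. A rooted ray is a run, so its links form the required
necklace. -/
theorem isNormalTree (hC : C.IsConnected) (h : Alive L (init C L)) :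
    C.IsNormalTree (ancestorSystem C L h).tree where
  verts_subset := by
    rintro u ⟨n, hn⟩
    exact dom_seq_subset_ground u n hn.mem
  incomparable := by
    rintro A hA u ⟨huA, m, hu⟩ v ⟨hvA, n, hv⟩ huv hvu
    by_contra hcon
    push Not at hcon
    rw [le_iff_of_picked h hu hv, not_and] at huv
    rw [le_iff_of_picked h hv hu, not_and] at hvu
    -- As long as `A` contains no common lower bound of `u` and `v`, deleting the current vertex
    -- does not touch `A`, so `A` passes into a single component and `u`, `v` keep the same state.
    -- At level `min m n` this makes them comparable.
    have key : ∀ j, j ≤ m → j ≤ n → seq C L u j = seq C L v j ∧ A ⊆ (seq C L u j).dom := by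
      intro j
      induction j with
      | zero => exact fun _ _ => ⟨rfl, hA.subset_ground⟩
      | succ j ih =>
        intro hjm hjn
        obtain ⟨heq, hsub⟩ := ih (by omega) (by omega)
        have hw := hu.vertex (show j ≤ m by omega)
        have hwA : (seq C L u j).vertex ∉ A := fun hwA => by
          refine hcon _ hwA ((le_iff_of_picked h hw hu).2 ⟨by omega, rfl⟩)
            ((le_iff_of_picked h hw hv).2 ⟨by omega, ?_⟩)
          rw [heq]
        have hA' : A ⊆ (seq C L u (j + 1)).dom := subset_componentOf
          (fun x hx => ⟨hsub hx, fun hxw => hwA (Set.mem_singleton_iff.1 hxw ▸ hx)⟩) hA huA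
        exact ⟨(seq_eq (hA' hvA)).symm, hA'⟩
    rcases le_total m n with hmn | hmn
    · refine huv hmn ?_
      rw [← (key m le_rfl hmn).1, hu.eq]
    · refine hvu hmn ?_
      rw [(key n hmn le_rfl).1, hv.eq]
  comparable := by
    intro u v huv
    obtain ⟨⟨m, hu⟩, ⟨n, hv⟩, -⟩ := AncestorSystem.le_iff _ |>.1 huv
    obtain ⟨hmn, heq⟩ := (le_iff_of_picked h hu hv).1 huv
    have hseq : seq C L u m = seq C L v m := by
      refine seq_eq ?_
      rw [← heq]
      exact hv.vertex_mem hmn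
    refine ⟨(seq C L u m).dom, conn_dom_seq hC u m, hu.mem, ?_, fun w hwu hne hw => ?_⟩
    · rw [hseq]
      exact antitone_dom_seq v hmn hv.mem
    · obtain ⟨⟨k, hk⟩, -⟩ := AncestorSystem.le_iff _ |>.1 hwu
      obtain ⟨hkm, hkeq⟩ := (le_iff_of_picked h hk hu).1 hwu
      rcases hkm.lt_or_eq with hlt | rfl
      · exact (dom_seq_succ u k (antitone_dom_seq u hlt hw)).2 hkeq.symm
      · exact hne (hkeq.symm.trans hu.eq)
  ray := by
    intro R hR
    have hpick : ∀ n, Picked C L (R n) n := by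
      intro n
      obtain ⟨m, hm⟩ : R n ∈ (ancestorSystem C L h).verts := (hR.2.2 n).1
      have : sInf {k | Picked C L (R n) k} = n :=
        (ancestorSystem C L h).height_of_isRootedRay hR n
      rw [hm.sInf_eq] at this
      exact this ▸ hm
    have hvert : ∀ n, (seq C L (R (n + 1)) n).vertex = R n := by
      intro n
      have := ((ancestorSystem C L h).isParent_of_isRootedRay hR n).2
      rwa [(ancestorSystem C L h).height_of_isRootedRay hR n] at this
    -- State `n` is read off from the sequence of `R n` and state `n + 1` from that of `R (n + 1)`;
    -- since `R n` is the `n`-th vertex on the way to `R (n + 1)`, `seq_eq` identifies the two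
    -- histories up to `n`.
    have hrun : IsRun C L fun n => seq C L (R n) n := by
      refine ⟨rfl, fun n => ⟨R (n + 1), ?_⟩, fun n => (hpick n).alive⟩
      have hmem := (hpick (n + 1)).vertex_mem (Nat.le_succ n)
      rw [hvert] at hmem
      simp only [seq]
      rw [← seq_eq hmem]
    refine ⟨_, hrun.isNecklace hC, ?_⟩
    convert Set.finite_empty
    rw [Set.sdiff_eq_empty]
    rintro _ ⟨n, rfl⟩
    have := hrun.vertex_mem_necklace hC n
    rwa [(hpick n).eq] at this

end TreeState

/-! ### Conclusion. -/

/-- In a connected connectoid, every `σ`-dispersed set is contained in a normal tree. -/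
theorem SigmaDispersed.exists_isNormalTree (hne : C.ground.Nonempty) (hC : C.IsConnected)
    {U : Set α} (hU : U ⊆ C.ground) (hdisp : C.SigmaDispersed U) :
    ∃ T : RootedGraphTree α, C.IsNormalTree T ∧ U ⊆ T.verts := by
  obtain ⟨s, hs⟩ := hne
  have : Nonempty α := ⟨s⟩
  -- The extra point `s` guarantees a root even if `U` is empty.
  obtain ⟨L, hL, hUL⟩ := hdisp.union (dispersed_of_finite (Set.finite_singleton s)).sigmaDispersed
  have halive : TreeState.Alive L (TreeState.init C L) := by
    obtain ⟨i, hi⟩ := Set.mem_iUnion.1 (hUL (Or.inr rfl))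
    exact ⟨i, s, hi, hs⟩
  refine ⟨_, TreeState.isNormalTree hC halive, fun u hu => ?_⟩
  obtain ⟨i, hi⟩ := Set.mem_iUnion.1 (hUL (Or.inl hu))
  exact TreeState.exists_picked hC hL hi (hU hu)

theorem endComponent_empty (hC : C.IsConnected) (ω : C.Ends) : C.endComponent ∅ ω = C.ground := by
  obtain ⟨hK, N, -, hN⟩ := C.endComponent_spec ∅ ω
  rw [Finset.coe_empty] at hK
  obtain ⟨x, hx⟩ := N.2.infinite.nonempty
  exact hK.eq_of_inter hC.isComponent_ground ⟨x, hN hx, N.2.1.subset_ground hx⟩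

theorem induce_ground_self : C.induce C.ground = C := by
  have h1 : (C.induce C.ground).ground = C.ground := Set.inter_self _
  have h2 : (C.induce C.ground).bonds = C.bonds :=
    Set.ext fun F => ⟨fun h => h.1, fun h => ⟨h, C.subset_ground F h⟩⟩
  cases C
  simp only [induce] at h1 h2 ⊢
  congr

end Connectoid

theorem theorem1p2 {α : Type*} (C : Connectoid α) (hne : C.ground.Nonempty)
    (hC : C.IsConnected) (U : Set α) (hU : U ⊆ C.ground) :
    (∃ T : RootedGraphTree α, C.IsNormalTree T ∧ U ⊆ T.verts) ↔
      ∀ ω : C.Ends, ∃ X : Finset α, (X : Set α) ⊆ C.ground ∧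
        ∃ T : RootedGraphTree α, (C.induce (C.endComponent X ω)).IsNormalTree T ∧
          U ∩ C.endComponent X ω ⊆ T.verts := by
  constructor
  · rintro ⟨T, hT, hUT⟩ ω
    refine ⟨∅, by simp, T, ?_, Set.inter_subset_left.trans hUT⟩
    rwa [Connectoid.endComponent_empty hC, Connectoid.induce_ground_self]
  · intro h
    refine Connectoid.SigmaDispersed.exists_isNormalTree hne hC hU
      (Connectoid.sigmaDispersed_of_local hC hU fun ω => ?_)
    obtain ⟨X, -, T, hT, hUT⟩ := h ω
    exact ⟨X, (hT.toIsWeakNormalTree.sigmaDispersed X.finite_toSet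
      (C.endComponent_spec X ω).1).mono hUT⟩
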